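/- Let $A\in\mathbb R^{m\times n}$, $b\in\mathbb R^m$, $c,u\in\mathbb R^n$, and consider the linear program $\min\langle c,x\rangle$ subject to $Ax=b$, $0\le x\le u$, with optimum value $\Phi$ if it is feasible. Write $\|A\|_1$ for the maximal $\ell_1$ norm of a column of $A$ and $\|A\|_2$ for the spectral norm. A vector $x\in[0,u]$ is *$\delta$-feasible* if $\|Ax-b\|_1\le\delta\|A\|_1$; for a feasible program, $x$ is *$\delta$-optimal* if $\langle c,x\rangle\le\Phi+\delta\|c\|_\infty$. A *$\delta$-certificate* for $x\in[0,u]$ is a triple $(\pi,w^+,w^-)\in\mathbb R^m\times\mathbb R^n\times\mathbb R^n$ with $A^\top\pi+w^--w^+=c$, with $0\le w_i^-\le 2\delta\|c\|_\infty/x_i$ and $0\le w_i^+\le 2\delta\|c\|_\infty/(u_i-x_i)$ for all $i$, and with $\|\pi\|_\infty\le 2\delta\|c\|_\infty/\|Ax-b\|_1$ (an upper bound with denominator $0$ is no restriction). For a subspace $W\subseteq\mathbb R^N$, let $\kappa(W)$ be the largest ratio $|g_j/g_i|$ over all support-minimal nonzero $g\in W$ and $i,j\in\mathrm{supp}(g)$,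 and $\kappa(W)=1$ if $W$ is $\{0\}$ or $\mathbb R^N$; put $\mathcal X_A=\ker(A\mid -I_m)$ and $\kappa=\kappa(\mathcal X_A)$. R-FGM denotes the fast (accelerated) projected gradient method with step size $1/L$ for $\min_{z\in X}f(z)$: from $z^0=y^0$, $t_0=1$, one iteration is $z^{k+1}=\mathrm{proj}_X\big(y^k-\tfrac1L\nabla f(y^k)\big)$, $t_{k+1}=\tfrac12\big(1+\sqrt{1+4t_k^2}\big)$, $y^{k+1}=z^{k+1}+\tfrac{t_k-1}{t_{k+1}}(z^{k+1}-z^k)$, and the method is restarted at its current iterate after every $h$ iterations. Algorithm *Dual-Certificate*, which is not given $\kappa$, makes runs for the guesses $\hat\kappa=1,2,4,\dots$. In each run R-FGM is started at $\pi=0$, with $L=\|A\|_2^2$ and $h=\lceil 2\mathrm e\, m\hat\kappa\|A\|_2\rceil$, and makes $h\cdot\max\{0,\lceil\log(\sqrt n\,\|u\|_1/(2\delta^{\mathrm{opt}}))\rceil\}$ iterations (none if $u=0$) on the problem $$\min_{\pi}\ \min_{w^+,w^-}\ \tfrac12\|A^\top\pi+w^--w^+-c\|_2^2,$$ where $(\pi,w^+,w^-)$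 ranges over the box given by all the inequalities in the definition of a $\delta^{\mathrm{opt}}$-certificate for $x$, and the objective as a function of $\pi$ is the inner minimum. The resulting $\pi$ is completed by $w^+=\max\{A^\top\pi-c,0\}$ and $w^-=\max\{c-A^\top\pi,0\}$. The algorithm stops and returns $(\pi,w^+,w^-)$ at the first run for which this is a $2\delta^{\mathrm{opt}}$-certificate for $x$. **Theorem.** There is an absolute constant $C>0$ such that the following holds. Suppose $\|A\|_1\ge1$, $\delta^{\mathrm{opt}}>0$, $0\le\delta^{\mathrm{feas}}\cdot n\cdot\kappa\cdot\|A\|_1\le\delta^{\mathrm{opt}}$, the linear program is feasible, and $x\in[0,u]$ is $\delta^{\mathrm{feas}}$-feasible and $\delta^{\mathrm{opt}}$-optimal. Then Dual-Certificate returns a $2\delta^{\mathrm{opt}}$-certificate for $x$, using in all its runs together at most $$C\cdot m\,\|A\|_2\,\kappa\cdot\max\{0,\log(n\|u\|_1/\delta^{\mathrm{opt}})\}$$ iterations of R-FGM (for $u=0$ this bound is read as $0$). -/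

import Mathlib

noncomputable section

/-! ### Circuit imbalances -/

/-- `g` is an elementary vector of `W`: a nonzero vector of `W` of inclusion-minimal support. -/
def IsElementary {ι : Type*} (W : Submodule ℝ (ι → ℝ)) (g : ι → ℝ) : Prop :=
  g ∈ W ∧ g ≠ 0 ∧ ∀ h ∈ W, h ≠ 0 → ¬ Function.support h ⊂ Function.support g

open Classical in
/-- The fractional circuit imbalance measure `κ(W)`: the largest ratio `|g j / g i|` over the
elementary vectors `g` of `W` and `i, j` in the support of `g`; it is `1` for trivial `W`. -/
def circuitImbalance {ι : Type*} (W : Submodule ℝ (ι → ℝ)) : ℝ :=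
  if W = ⊥ ∨ W = ⊤ then 1
  else sSup {r : ℝ | ∃ g, IsElementary W g ∧ ∃ i ∈ Function.support g, ∃ j ∈ Function.support g,
    r = |g j / g i|}

/-- `𝒳_A = ker (A | -I)`. -/
def extendedSubspace {m n : ℕ} (A : Matrix (Fin m) (Fin n) ℝ) :
    Submodule ℝ (Fin n ⊕ Fin m → ℝ) :=
  LinearMap.ker (Matrix.mulVecLin (Matrix.fromCols A (-1 : Matrix (Fin m) (Fin m) ℝ)))

/-- `κ(𝒳_A)`. -/
def kappaX {m n : ℕ} (A : Matrix (Fin m) (Fin n) ℝ) : ℝ :=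
  circuitImbalance (extendedSubspace A)

/-! ### Norms.  The norm `‖c‖` of `c : Fin n → ℝ` in Mathlib is the maximum norm `‖c‖_∞`. -/

/-- The `ℓ₁` norm of a vector. -/
def l1Norm {n : ℕ} (v : Fin n → ℝ) : ℝ := ∑ i, |v i|

/-- `‖A‖₁`, the maximal `ℓ₁` norm of a column. -/
def matrixL1Norm {m n : ℕ} (A : Matrix (Fin m) (Fin n) ℝ) : ℝ := ⨆ j, ∑ i, |A i j|

/-- The spectral norm `‖A‖₂`: the operator norm for the Euclidean norms. -/
def spectralNorm₂ {m n : ℕ} (A : Matrix (Fin m) (Fin n) ℝ) : ℝ :=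
  ‖LinearMap.toContinuousLinearMap (Matrix.toEuclideanLin A)‖

/-! ### The linear program `min ⟨c, x⟩` subject to `A x = b`, `0 ≤ x ≤ u` -/

/-- The feasible region. -/
def feasibleRegion {m n : ℕ} (A : Matrix (Fin m) (Fin n) ℝ) (b : Fin m → ℝ) (u : Fin n → ℝ) :
    Set (Fin n → ℝ) :=
  {x | A.mulVec x = b ∧ x ∈ Set.Icc 0 u}

/-- The optimum value `Φ(A,b,c,u)` (of a feasible program; the feasible region is compact). -/
def optValue {m n : ℕ} (A : Matrix (Fin m) (Fin n) ℝ) (b : Fin m → ℝ) (c u : Fin n → ℝ) : ℝ :=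
  sInf ((fun x => c ⬝ᵥ x) '' feasibleRegion A b u)

/-- `x` is `δ`-feasible. -/
def IsDeltaFeasible {m n : ℕ} (A : Matrix (Fin m) (Fin n) ℝ) (b : Fin m → ℝ) (u : Fin n → ℝ)
    (δ : ℝ) (x : Fin n → ℝ) : Prop :=
  x ∈ Set.Icc 0 u ∧ l1Norm (A.mulVec x - b) ≤ δ * matrixL1Norm A

/-- `x` is `δ`-optimal; this presupposes that the linear program is feasible. -/
def IsDeltaOptimal {m n : ℕ} (A : Matrix (Fin m) (Fin n) ℝ) (b : Fin m → ℝ) (c u : Fin n → ℝ)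
    (δ : ℝ) (x : Fin n → ℝ) : Prop :=
  (feasibleRegion A b u).Nonempty ∧ c ⬝ᵥ x ≤ optValue A b c u + δ * ‖c‖

/-- `(π, w⁺, w⁻)` is a `δ`-certificate for `x ∈ [0,u]`. The upper bounds `2δ‖c‖_∞ / x i`,
`2δ‖c‖_∞ / (u i - x i)` and `2δ‖c‖_∞ / ‖A x - b‖₁` are cleared of their denominators:
a bound with denominator `0` is no restriction. -/
def IsCertificate {m n : ℕ} (A : Matrix (Fin m) (Fin n) ℝ) (b : Fin m → ℝ) (c u x : Fin n → ℝ)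
    (δ : ℝ) (π : Fin m → ℝ) (wp wm : Fin n → ℝ) : Prop :=
  A.transpose.mulVec π + wm - wp = c ∧
  (∀ i, 0 ≤ wm i ∧ wm i * x i ≤ 2 * δ * ‖c‖) ∧
  (∀ i, 0 ≤ wp i ∧ wp i * (u i - x i) ≤ 2 * δ * ‖c‖) ∧
  ‖π‖ * l1Norm (A.mulVec x - b) ≤ 2 * δ * ‖c‖

/-! ### The restarted fast gradient method R-FGM for `min f` over a closed convex set `X` -/

section RFGM

variable {E : Type*} [NormedAddCommGroup E] [InnerProductSpace ℝ E] [CompleteSpace E]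

/-- The Euclidean projection of `y` to `X`, the nearest point of `X`. -/
def nearestPoint (X : Set E) (y : E) : E :=
  Classical.epsilon fun p => p ∈ X ∧ ∀ q ∈ X, ‖y - p‖ ≤ ‖y - q‖

/-- The data kept by the fast gradient method: the iterate `x`, the extrapolated point `y` and
the momentum parameter `t`. -/
structure FGMState (E : Type*) where
  x : E
  y : E
  t : ℝ

/-- One iteration (one projected gradient update with step `1/L`, and extrapolation). -/
def fgmStep (f : E → ℝ) (X : Set E) (L : ℝ) (s : FGMState E) : FGMState E :=
  let x' := nearestPoint X (s.y - (1 / L) • gradient f s.y)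
  let t' := (1 + Real.sqrt (1 + 4 * s.t ^ 2)) / 2
  { x := x', y := x' + ((s.t - 1) / t') • (x' - s.x), t := t' }

/-- The iterate after `k` iterations of the fast gradient method started at `x₀`. -/
def fgm (f : E → ℝ) (X : Set E) (L : ℝ) (x₀ : E) (k : ℕ) : E :=
  ((fgmStep f X L)^[k] { x := x₀, y := x₀, t := 1 }).x

/-- The iterate after `N` iterations in total of R-FGM started at `x₀`: the fast gradient method
is restarted at the current iterate after every `h` iterations. -/
def rfgm (f : E → ℝ) (X : Set E) (L : ℝ) (h : ℕ) (x₀ : E) (N : ℕ) : E :=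
  fgm f X L ((fun z => fgm f X L z h)^[N / h] x₀) (N % h)

end RFGM

/-! ### The algorithm Dual-Certificate -/

/-- The amount by which `s` exceeds `D / a`, where `D / 0 = ∞`. -/
def capExcess (D a s : ℝ) : ℝ := if a = 0 then 0 else max 0 (s - D / a)

/-- The objective of Dual-Certificate: with `s = c - Aᵀ π` and `D = 2δ‖c‖_∞`, it is the minimum of
`‖Aᵀ π + w⁻ - w⁺ - c‖₂² / 2` over all `0 ≤ w⁻ i ≤ D / x i` and `0 ≤ w⁺ i ≤ D / (u i - x i)`. -/
def dualObjective {m n : ℕ} (A : Matrix (Fin m) (Fin n) ℝ) (c u x : Fin n → ℝ) (δ : ℝ)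
    (π : EuclideanSpace ℝ (Fin m)) : ℝ :=
  1 / 2 * ∑ i, (capExcess (2 * δ * ‖c‖) (x i) ((c - A.transpose.mulVec π.ofLp) i) ^ 2 +
    capExcess (2 * δ * ‖c‖) (u i - x i) (-(c - A.transpose.mulVec π.ofLp) i) ^ 2)

/-- The domain of Dual-Certificate: `|π j| ≤ 2δ‖c‖_∞ / ‖A x - b‖₁` for all `j`. -/
def dualDomain {m n : ℕ} (A : Matrix (Fin m) (Fin n) ℝ) (b : Fin m → ℝ) (c x : Fin n → ℝ)
    (δ : ℝ) : Set (EuclideanSpace ℝ (Fin m)) :=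
  {π | ∀ j, |π j| * l1Norm (A.mulVec x - b) ≤ 2 * δ * ‖c‖}

/-- The restart length `⌈2e √(L/μ)⌉` of R-FGM for `L = ‖A‖₂²` and `μ = 1 / (m κ)²`, where `κ` is
a guess of `κ(𝒳_A)`. -/
def restartLength {m n : ℕ} (A : Matrix (Fin m) (Fin n) ℝ) (κ : ℝ) : ℕ :=
  ⌈2 * Real.exp 1 * (m * κ * spectralNorm₂ A)⌉₊

/-- The number of R-FGM iterations of the run with guess `κ`. -/
def attemptIterations {m n : ℕ} (A : Matrix (Fin m) (Fin n) ℝ) (u : Fin n → ℝ) (δ κ : ℝ) : ℕ :=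
  ⌈Real.log (Real.sqrt n * l1Norm u / (2 * δ))⌉₊ * restartLength A κ

/-- The vector `π` computed by the R-FGM run with guess `κ`, started from `0`. -/
def attempt {m n : ℕ} (A : Matrix (Fin m) (Fin n) ℝ) (b : Fin m → ℝ) (c u x : Fin n → ℝ)
    (δ κ : ℝ) : Fin m → ℝ :=
  (rfgm (dualObjective A c u x δ) (dualDomain A b c x δ) (spectralNorm₂ A ^ 2)
    (restartLength A κ) 0 (attemptIterations A u δ κ)).ofLp

/-- The extension of a dual vector `π` by `w⁺ = max {Aᵀ π - c, 0}`. -/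
def dualSlackPlus {m n : ℕ} (A : Matrix (Fin m) (Fin n) ℝ) (c : Fin n → ℝ) (π : Fin m → ℝ) :
    Fin n → ℝ :=
  fun i => max ((A.transpose.mulVec π) i - c i) 0

/-- The extension of a dual vector `π` by `w⁻ = max {c - Aᵀ π, 0}`. -/
def dualSlackMinus {m n : ℕ} (A : Matrix (Fin m) (Fin n) ℝ) (c : Fin n → ℝ) (π : Fin m → ℝ) :
    Fin n → ℝ :=
  fun i => max (c i - (A.transpose.mulVec π) i) 0

/-- Dual-Certificate makes the runs with guesses `κ = 1, 2, 4, …` and stops after the first run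
whose result, extended by its slacks, passes the check for a `2δ`-certificate.
This is the index of that run. -/
def dualCertificateStop {m n : ℕ} (A : Matrix (Fin m) (Fin n) ℝ) (b : Fin m → ℝ)
    (c u x : Fin n → ℝ) (δ : ℝ) : ℕ :=
  sInf {j : ℕ | IsCertificate A b c u x (2 * δ) (attempt A b c u x δ (2 ^ j))
    (dualSlackPlus A c (attempt A b c u x δ (2 ^ j)))
    (dualSlackMinus A c (attempt A b c u x δ (2 ^ j)))}

/-- The vector `π` returned by Dual-Certificate (together with its slacks). -/
def dualCertificate {m n : ℕ} (A : Matrix (Fin m) (Fin n) ℝ) (b : Fin m → ℝ)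
    (c u x : Fin n → ℝ) (δ : ℝ) : Fin m → ℝ :=
  attempt A b c u x δ (2 ^ dualCertificateStop A b c u x δ)

/-- The total number of R-FGM iterations of Dual-Certificate, over all the runs it makes. -/
def dualCertificateIterations {m n : ℕ} (A : Matrix (Fin m) (Fin n) ℝ) (b : Fin m → ℝ)
    (c u x : Fin n → ℝ) (δ : ℝ) : ℕ :=
  ∑ j ∈ Finset.range (dualCertificateStop A b c u x δ + 1), attemptIterations A u δ (2 ^ j)

end

/-! Write f for the dual objective and δ for `δopt`. Three facts make every run with a guess of at
least κ succeed. (1) f has a zero in the box (`dualZeros_nonempty`). An optimal dual solution can be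
chosen with entries at most nκ‖c‖_∞ (`exists_dual_of_min`), and complementary slackness turns
near-feasibility and near-optimality of x into the bounds of a certificate. (2) f is convex and
‖A‖₂²-smooth (`isConvexSmooth_dualObjective`). (3) f need not be strongly convex, but it grows
quadratically away from its zeros: dist² ≤ (mκ)²·2f on the box (`dualObjective_quadratic_growth`).
This is a Hoffman bound, read off from the normal cone at the projection to the zero set.

In (1) and (3), κ enters through one piece of linear algebra: in a basis of unit vectors and columns
of a matrix, coordinates are entries of fundamental circuits or cocircuits, hence bounded by κ
(`abs_coord_le_kappaX`, `abs_coord_le_kappaX_transpose`).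

The O(1/k²) rate of the fast gradient method, measured against a zero near the restart point,
divides f by e² in each round of h iterations (`restarted_fgm_rate`). After T rounds every excess
over a cap is at most e^(-T)√n‖c‖_∞; the chosen T makes this times ‖u‖₁ at most 2δ‖c‖_∞, so the
bounds of a δ-certificate at most double. The search stops at a guess of at most 2κ, and the run
lengths are dominated by a geometric series. -/

open scoped RealInnerProductSpace

/-! ### Elementary vectors and circuit imbalances -/

section Circuits

variable {ι : Type*} [Fintype ι] {W : Submodule ℝ (ι → ℝ)}

/-- Cancelling entry `i` leaves a vector of strictly smaller support, which minimality forces to be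
zero. -/
lemma IsElementary.eq_smul {g h : ι → ℝ} (hg : IsElementary W g) (hh : h ∈ W)
    (hs : Function.support h ⊆ Function.support g) {i : ι} (hi : h i ≠ 0) :
    g = (g i / h i) • h := by
  by_contra hne
  have hmem : g - (g i / h i) • h ∈ W := W.sub_mem hg.1 (W.smul_mem _ hh)
  refine hg.2.2 _ hmem (sub_ne_zero.2 hne) ?_
  rw [Set.ssubset_iff_of_subset]
  · exact ⟨i, hs hi, by simp [hi]⟩
  · intro j hj
    by_contra hgj
    have hgj' : g j = 0 := by simpa using hgj
    have hhj : h j = 0 := by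
      by_contra hhj
      exact hgj (hs hhj)
    simp [hgj', hhj] at hj

/-- An elementary vector is determined up to scaling by its support, so a ratio depends only on the
support and two indices, and there are finitely many. Without this the `sSup` in κ would carry no
information. -/
lemma bddAbove_imbalances (W : Submodule ℝ (ι → ℝ)) :
    BddAbove {r : ℝ | ∃ g, IsElementary W g ∧ ∃ i ∈ Function.support g, ∃ j ∈ Function.support g,
      r = |g j / g i|} := by
  classical
  let G : Set ι → ι → ℝ := fun S =>
    if h : ∃ g, IsElementary W g ∧ Function.support g = S then h.choose else 0
  refine (Set.Finite.subset (Set.finite_range fun p : Set ι × ι × ι =>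
    |G p.1 p.2.2 / G p.1 p.2.1|) ?_).bddAbove
  rintro r ⟨g, hg, i, hi, j, hj, rfl⟩
  refine ⟨(Function.support g, i, j), ?_⟩
  have hex : ∃ g', IsElementary W g' ∧ Function.support g' = Function.support g := ⟨g, hg, rfl⟩
  have hG : G (Function.support g) = hex.choose := dif_pos hex
  obtain ⟨h1, h2⟩ := hex.choose_spec
  rw [← hG] at h1 h2
  have hi' : G (Function.support g) i ≠ 0 := by
    have : i ∈ Function.support (G (Function.support g)) := by rw [h2]; exact hi
    exact this
  have hgi : g i ≠ 0 := hi
  have key := hg.eq_smul h1.1 h2.le hi'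
  have hj' : g j = g i / G (Function.support g) i * G (Function.support g) j := congrFun key j
  simp only
  rw [hj']
  congr 1
  field_simp

lemma exists_isElementary (hW : W ≠ ⊥) : ∃ g, IsElementary W g := by
  classical
  obtain ⟨w, hw, hw0⟩ := (Submodule.ne_bot_iff W).1 hW
  have hne : ∃ k, ∃ g ∈ W, g ≠ 0 ∧ (Function.support g).ncard = k := ⟨_, w, hw, hw0, rfl⟩
  obtain ⟨g, hg, hg0, hgk⟩ := Nat.find_spec hne
  refine ⟨g, hg, hg0, fun h hh hh0 hlt => ?_⟩
  refine Nat.find_min hne (m := (Function.support h).ncard) ?_ ⟨h, hh, hh0, rfl⟩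
  rw [← hgk]
  exact Set.ncard_lt_ncard hlt (Set.toFinite _)

lemma one_le_circuitImbalance (W : Submodule ℝ (ι → ℝ)) : 1 ≤ circuitImbalance W := by
  unfold circuitImbalance
  split_ifs with h
  · exact le_rfl
  · push Not at h
    obtain ⟨g, hg⟩ := exists_isElementary h.1
    obtain ⟨i, hi⟩ := Function.ne_iff.1 hg.2.1
    refine le_csSup (bddAbove_imbalances W) ⟨g, hg, i, hi, i, hi, ?_⟩
    simp only [Pi.zero_apply, ne_eq] at hi
    rw [div_self hi, abs_one]

/-- A vector of `W` that is determined, among the vectors of `W` supported on its support, by its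
`i`-th entry is elementary, which bounds its entries by the `i`-th one. -/
lemma abs_le_circuitImbalance_mul (hW : W ≠ ⊤) {g : ι → ℝ} (hg : g ∈ W) {i : ι} (hi : g i ≠ 0)
    (hdet : ∀ h ∈ W, Function.support h ⊆ Function.support g → h i = 0 → h = 0) (j : ι) :
    |g j| ≤ circuitImbalance W * |g i| := by
  have hpos : 0 < |g i| := abs_pos.2 hi
  by_cases hj : g j = 0
  · rw [hj, abs_zero]
    exact mul_nonneg (zero_le_one.trans (one_le_circuitImbalance W)) hpos.le
  have hg0 : g ≠ 0 := fun h => hi (by rw [h]; rfl)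
  have hel : IsElementary W g := by
    refine ⟨hg, hg0, fun h hh hh0 hlt => ?_⟩
    have hhi : h i ≠ 0 := fun h0 => hh0 (hdet h hh hlt.1 h0)
    -- The difference vanishes at `i`, hence everywhere; so `g` is a multiple of `h` and its support
    -- is not larger.
    have h0 := hdet (g - (g i / h i) • h) (W.sub_mem hg (W.smul_mem _ hh)) ?_ (by simp [hhi])
    · refine hlt.2 fun k hk hk0 => hk ?_
      have hk' := congrFun h0 k
      simp only [Pi.sub_apply, Pi.smul_apply, smul_eq_mul, Pi.zero_apply] at hk'
      rw [hk0, mul_zero, sub_zero] at hk'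
      exact hk'
    · intro k hk
      by_contra hgk
      have hgk' : g k = 0 := by simpa using hgk
      have hhk : h k = 0 := by
        by_contra hhk
        exact hgk (hlt.1 hhk)
      simp [hgk', hhk] at hk
  have hbot : W ≠ ⊥ := fun h => hg0 (by simpa [h] using hg)
  rw [← div_le_iff₀ hpos, ← abs_div, circuitImbalance, if_neg (by tauto)]
  exact le_csSup (bddAbove_imbalances W) ⟨g, hel, i, hi, j, hj, rfl⟩

end Circuits

section ExtendedSubspace

variable {m n : ℕ} {A : Matrix (Fin m) (Fin n) ℝ}

lemma mem_extendedSubspace {g : Fin n ⊕ Fin m → ℝ} :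
    g ∈ extendedSubspace A ↔ A.mulVec (g ∘ Sum.inl) = g ∘ Sum.inr := by
  rw [extendedSubspace, LinearMap.mem_ker, Matrix.mulVecLin_apply, Matrix.fromCols_mulVec,
    Matrix.neg_mulVec, Matrix.one_mulVec, ← sub_eq_add_neg, sub_eq_zero]

lemma extendedSubspace_ne_top [Nonempty (Fin m)] : extendedSubspace A ≠ ⊤ := by
  intro h
  have hmem : (Sum.elim 0 1 : Fin n ⊕ Fin m → ℝ) ∈ extendedSubspace A := h ▸ Submodule.mem_top
  rw [mem_extendedSubspace, Sum.elim_comp_inl, Sum.elim_comp_inr, Matrix.mulVec_zero] at hmem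
  have := congrFun hmem (Classical.arbitrary _)
  simp at this

lemma one_le_kappaX : 1 ≤ kappaX A := one_le_circuitImbalance _

/-- The bound of `abs_le_circuitImbalance_mul` for the vectors `(y, A y)`. -/
lemma abs_le_kappaX [Nonempty (Fin m)] {y : Fin n → ℝ} {i : Fin n ⊕ Fin m}
    (hi : Sum.elim y (A.mulVec y) i = 1)
    (hdet : ∀ z : Fin n → ℝ, (∀ k, y k = 0 → z k = 0) →
      (∀ j, A.mulVec y j = 0 → A.mulVec z j = 0) → Sum.elim z (A.mulVec z) i = 0 → z = 0)
    (j : Fin n ⊕ Fin m) : |Sum.elim y (A.mulVec y) j| ≤ kappaX A := by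
  have h := abs_le_circuitImbalance_mul (W := extendedSubspace A) extendedSubspace_ne_top
    (g := Sum.elim y (A.mulVec y)) (i := i) ?_ ?_ ?_ j
  · rwa [hi, abs_one, mul_one] at h
  · rw [mem_extendedSubspace, Sum.elim_comp_inl, Sum.elim_comp_inr]
  · rw [hi]; exact one_ne_zero
  · intro h hh hs h0
    rw [mem_extendedSubspace] at hh
    have hh' : h = Sum.elim (h ∘ Sum.inl) (A.mulVec (h ∘ Sum.inl)) := by
      rw [hh, Sum.elim_comp_inl_inr]
    have hz : h ∘ Sum.inl = 0 := by
      refine hdet _ (fun k hk => ?_) (fun k hk => ?_) (by rw [← hh']; exact h0)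
      · by_contra hne
        exact hs (show Sum.inl k ∈ Function.support h from hne) hk
      · by_contra hne
        rw [hh] at hne
        exact hs (show Sum.inr k ∈ Function.support h from hne) hk
    rw [hh', hz, Matrix.mulVec_zero]
    ext (k | k) <;> rfl

end ExtendedSubspace

/-! ### Conic combinations with sign constraints -/

lemma linearIndepOn_iff_forall_support {ι E : Type*} [Fintype ι] [AddCommGroup E] [Module ℝ E]
    {v : ι → E} {s : Set ι} :
    LinearIndepOn ℝ v s ↔
      ∀ f : ι → ℝ, Function.support f ⊆ s → ∑ i, f i • v i = 0 → f = 0 := by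
  classical
  have hs : s = (s.toFinset : Set ι) := by simp
  rw [hs, linearIndepOn_finset_iff]
  constructor
  · intro h f hf h0
    have hz : ∀ i, i ∉ s → f i = 0 := fun i hi => by
      by_contra hne
      exact hi (by simpa using hf hne)
    have h1 := h f (by
      rw [← h0]
      refine Finset.sum_subset (Finset.subset_univ _) fun i _ hi => ?_
      rw [hz i (by simpa using hi), zero_smul])
    ext i
    by_cases hi : i ∈ s
    · exact h1 i (by simpa using hi)
    · exact hz i hi
  · intro h f h0 i hi
    have := h (fun i => if i ∈ s then f i else 0) (fun i hi => by
      by_contra hne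
      have : i ∉ s := by simpa using hne
      simp [this] at hi) (by
      rw [← h0]
      refine (Finset.sum_subset (Finset.subset_univ s.toFinset) fun i _ hi => ?_).symm.trans
        (Finset.sum_congr rfl fun i hi => ?_)
      · have : i ∉ s := by simpa using hi
        simp [this]
      · have : i ∈ s := by simpa using hi
        simp [this])
    have h2 := congrFun this i
    have hi' : i ∈ s := by simpa using hi
    simpa [hi'] using h2

section SignedCone

variable {ι : Type*}

/-- The coefficient vectors that are nonnegative outside `N` and nonpositive outside `P`. -/
def signedCoeffs (P N : Set ι) : Set (ι → ℝ) :=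
  {l | ∀ i, (0 < l i → i ∈ P) ∧ (l i < 0 → i ∈ N)}

variable {P N : Set ι}

lemma isClosed_signedCoeffs : IsClosed (signedCoeffs P N) := by
  have : signedCoeffs P N = ⋂ i, ({l | i ∈ P ∨ l i ≤ 0} ∩ {l | i ∈ N ∨ 0 ≤ l i}) := by
    ext l
    simp only [signedCoeffs, Set.mem_ofPred_eq, Set.mem_iInter, Set.mem_inter_iff]
    refine forall_congr' fun i => and_congr ?_ ?_
    · rw [← not_lt, or_comm, imp_iff_not_or]
    · rw [← not_lt, or_comm, imp_iff_not_or]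
  rw [this]
  refine isClosed_iInter fun i => IsClosed.inter ?_ ?_
  · by_cases h : i ∈ P
    · simp [h]
    · simpa [h] using isClosed_le (continuous_apply i) continuous_const
  · by_cases h : i ∈ N
    · simp [h]
    · simpa [h] using isClosed_le continuous_const (continuous_apply i)

lemma signedCoeffs_add {l l' : ι → ℝ} (h : l ∈ signedCoeffs P N) (h' : l' ∈ signedCoeffs P N) :
    l + l' ∈ signedCoeffs P N := by
  intro i
  constructor
  · intro hpos
    by_contra hi
    have h1 := not_lt.1 fun hh => hi ((h i).1 hh)
    have h2 := not_lt.1 fun hh => hi ((h' i).1 hh)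
    simp only [Pi.add_apply] at hpos
    linarith
  · intro hneg
    by_contra hi
    have h1 := not_lt.1 fun hh => hi ((h i).2 hh)
    have h2 := not_lt.1 fun hh => hi ((h' i).2 hh)
    simp only [Pi.add_apply] at hneg
    linarith

lemma signedCoeffs_smul {l : ι → ℝ} (h : l ∈ signedCoeffs P N) {a : ℝ} (ha : 0 ≤ a) :
    a • l ∈ signedCoeffs P N := by
  refine fun i => ⟨fun hp => (h i).1 ?_, fun hp => (h i).2 ?_⟩
  · exact pos_of_mul_pos_right hp ha
  · by_contra hl
    exact absurd hp (not_lt.2 (mul_nonneg ha (not_lt.1 hl)))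

variable [Fintype ι] {E : Type*} [AddCommGroup E] [Module ℝ E]

/-- One step of the reduction of the support of a conic combination. -/
lemma exists_support_ssubset {v : ι → E} {l : ι → ℝ} (hl : l ∈ signedCoeffs P N)
    (hdep : ¬ LinearIndepOn ℝ v (Function.support l)) :
    ∃ l' ∈ signedCoeffs P N, Function.support l' ⊂ Function.support l ∧
      ∑ i, l' i • v i = ∑ i, l i • v i := by
  classical
  rw [linearIndepOn_iff_forall_support] at hdep
  push Not at hdep
  obtain ⟨μ, hμs, hμ0, hμ⟩ := hdep
  obtain ⟨i₀, hi₀⟩ := Function.ne_iff.1 hμ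
  -- The minimal ratio is the largest multiple of the dependency `μ` that can be subtracted without
  -- changing a sign of `l`; it cancels entry `i`.
  obtain ⟨i, hi, hmin⟩ := Finset.exists_min_image (Finset.univ.filter fun i => μ i ≠ 0)
    (fun i => |l i| / |μ i|) ⟨i₀, by simpa using hi₀⟩
  have hμi : μ i ≠ 0 := by simpa using hi
  set r := l i / μ i with hr
  have key : ∀ k, |r * μ k| ≤ |l k| := fun k => by
    by_cases hk : μ k = 0
    · simp [hk]
    · have := hmin k (by simpa using hk)
      rw [abs_mul, hr, abs_div]
      rwa [le_div_iff₀ (abs_pos.2 hk)] at this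
  refine ⟨fun k => l k - r * μ k, fun k => ⟨fun h => (hl k).1 ?_, fun h => (hl k).2 ?_⟩, ?_, ?_⟩
  · by_contra hk
    have := key k
    rw [abs_of_nonpos (not_lt.1 hk)] at this
    have := neg_abs_le (r * μ k)
    simp only at h
    linarith
  · by_contra hk
    have := key k
    rw [abs_of_nonneg (not_lt.1 hk)] at this
    have := le_abs_self (r * μ k)
    simp only at h
    linarith
  · rw [Set.ssubset_iff_of_subset]
    · exact ⟨i, hμs hμi, by simp [hr, hμi]⟩
    · intro k hk hlk
      have : μ k = 0 := by
        by_contra hne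
        exact hμs hne hlk
      simp [hlk, this] at hk
  · simp only [sub_smul, Finset.sum_sub_distrib, mul_smul, ← Finset.smul_sum, hμ0, smul_zero,
      sub_zero]

/-- **Carathéodory's theorem** for cones: a conic combination can be chosen with linearly
independent vectors. -/
lemma exists_linearIndepOn_support {v : ι → E} {l : ι → ℝ} (hl : l ∈ signedCoeffs P N) :
    ∃ l' ∈ signedCoeffs P N, LinearIndepOn ℝ v (Function.support l') ∧
      ∑ i, l' i • v i = ∑ i, l i • v i := by
  classical
  have hne : ∃ k, ∃ l' ∈ signedCoeffs P N, ∑ i, l' i • v i = ∑ i, l i • v i ∧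
    (Function.support l').ncard = k := ⟨_, l, hl, rfl, rfl⟩
  obtain ⟨l', hl', hsum, hk⟩ := Nat.find_spec hne
  refine ⟨l', hl', ?_, hsum⟩
  by_contra hdep
  obtain ⟨l'', h1, h2, h3⟩ := exists_support_ssubset hl' hdep
  refine Nat.find_min hne (m := (Function.support l'').ncard) ?_ ⟨l'', h1, h3.trans hsum, rfl⟩
  rw [← hk]
  exact Set.ncard_lt_ncard h2 (Set.toFinite _)

end SignedCone

/-! ### Projections, polyhedra and Farkas' lemma -/

lemma exists_nearest {E : Type*} [NormedAddCommGroup E] [InnerProductSpace ℝ E] [CompleteSpace E]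
    {K : Set E} (hne : K.Nonempty) (hc : IsClosed K) (hK : Convex ℝ K) (d : E) :
    ∃ p ∈ K, (∀ w ∈ K, ⟪d - p, w - p⟫ ≤ 0) ∧ ∀ w ∈ K, ‖d - p‖ ≤ ‖d - w‖ := by
  obtain ⟨p, hp, hmin⟩ := exists_norm_eq_iInf_of_complete_convex hne hc.isComplete hK d
  refine ⟨p, hp, (norm_eq_iInf_iff_real_inner_le_zero hK hp).1 hmin, fun w hw => ?_⟩
  rw [hmin]
  exact ciInf_le ⟨0, Set.forall_mem_range.2 fun _ => norm_nonneg _⟩ (⟨w, hw⟩ : K)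

section Polyhedron

variable {ι E : Type*} [NormedAddCommGroup E] [InnerProductSpace ℝ E]

/-- A polyhedron with upper bounds `hi` for the indices in `U` and lower bounds `lo` for those
in `V`. -/
def polyhedron (v : ι → E) (U V : Set ι) (lo hi : ι → ℝ) : Set E :=
  {z | (∀ i ∈ U, ⟪v i, z⟫ ≤ hi i) ∧ ∀ i ∈ V, lo i ≤ ⟪v i, z⟫}

lemma convex_polyhedron (v : ι → E) (U V : Set ι) (lo hi : ι → ℝ) :
    Convex ℝ (polyhedron v U V lo hi) := by
  intro a ha b hb r s hr hs hrs
  refine ⟨fun i hi' => ?_, fun i hi' => ?_⟩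
  · rw [inner_add_right, inner_smul_right, inner_smul_right]
    have h1 := mul_le_mul_of_nonneg_left (ha.1 i hi') hr
    have h2 := mul_le_mul_of_nonneg_left (hb.1 i hi') hs
    have h3 : r * hi i + s * hi i = hi i := by rw [← add_mul, hrs, one_mul]
    linarith
  · rw [inner_add_right, inner_smul_right, inner_smul_right]
    have h1 := mul_le_mul_of_nonneg_left (ha.2 i hi') hr
    have h2 := mul_le_mul_of_nonneg_left (hb.2 i hi') hs
    have h3 : r * lo i + s * lo i = lo i := by rw [← add_mul, hrs, one_mul]
    linarith

lemma isClosed_polyhedron (v : ι → E) (U V : Set ι) (lo hi : ι → ℝ) :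
    IsClosed (polyhedron v U V lo hi) := by
  have : polyhedron v U V lo hi =
      (⋂ i ∈ U, {z | ⟪v i, z⟫ ≤ hi i}) ∩ ⋂ i ∈ V, {z | lo i ≤ ⟪v i, z⟫} := by
    ext z; simp [polyhedron]
  rw [this]
  refine IsClosed.inter (isClosed_biInter fun i _ => ?_) (isClosed_biInter fun i _ => ?_)
  · exact isClosed_le (by fun_prop) continuous_const
  · exact isClosed_le continuous_const (by fun_prop)

end Polyhedron

section Farkas

variable {ι : Type*} [Fintype ι] {E : Type*} [NormedAddCommGroup E] [InnerProductSpace ℝ E]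
  {P N : Set ι}

/-- By Carathéodory the cone is a finite union of pieces spanned by independent families, and each
piece is the image of a closed set under an injective linear map from a finite-dimensional space. -/
lemma isClosed_image_signedCoeffs (v : ι → E) :
    IsClosed ((fun l : ι → ℝ => ∑ i, l i • v i) '' signedCoeffs P N) := by
  have hun : (fun l : ι → ℝ => ∑ i, l i • v i) '' signedCoeffs P N =
      ⋃ s ∈ {s : Set ι | LinearIndepOn ℝ v s},
        (fun l : ι → ℝ => ∑ i, l i • v i) ''
          (signedCoeffs P N ∩ {l | Function.support l ⊆ s}) := by
    ext d
    simp only [Set.mem_iUnion]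
    constructor
    · rintro ⟨l, hl, rfl⟩
      obtain ⟨l', h1, h2, h3⟩ := exists_linearIndepOn_support (v := v) hl
      exact ⟨_, h2, l', ⟨h1, Set.Subset.rfl⟩, h3⟩
    · rintro ⟨s, _, l, hl, rfl⟩
      exact ⟨l, hl.1, rfl⟩
  rw [hun]
  refine (Set.toFinite _).isClosed_biUnion fun s hs => ?_
  let S : Submodule ℝ (ι → ℝ) :=
    { carrier := {l | Function.support l ⊆ s}
      zero_mem' := by simp
      add_mem' := fun {a b} ha hb => (Function.support_add a b).trans (Set.union_subset ha hb)
      smul_mem' := fun c a ha => (Function.support_const_smul_subset c a).trans ha }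
  let T : S →ₗ[ℝ] E := (Fintype.linearCombination ℝ v).comp S.subtype
  have hT : Function.Injective T := by
    rw [← LinearMap.ker_eq_bot, LinearMap.ker_eq_bot']
    rintro ⟨l, hl⟩ h0
    exact Subtype.ext (linearIndepOn_iff_forall_support.1 hs l hl h0)
  have hcl := (LinearMap.isClosedEmbedding_of_injective (f := T) (LinearMap.ker_eq_bot.2 hT)
    ).isClosedMap _ (isClosed_signedCoeffs (P := P) (N := N) |>.preimage continuous_subtype_val)
  convert hcl using 1
  ext d
  constructor
  · rintro ⟨l, ⟨h1, h2⟩, rfl⟩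
    exact ⟨⟨l, h2⟩, h1, rfl⟩
  · rintro ⟨⟨l, h2⟩, h1, rfl⟩
    exact ⟨l, ⟨h1, h2⟩, rfl⟩

variable [CompleteSpace E]

/-- **Farkas' lemma**, with linearly independent vectors in the conic combination. -/
lemma farkas (v : ι → E) (d : E)
    (h : ∀ y, (∀ i ∈ P, ⟪v i, y⟫ ≤ 0) → (∀ i ∈ N, 0 ≤ ⟪v i, y⟫) → ⟪d, y⟫ ≤ 0) :
    ∃ l ∈ signedCoeffs P N, LinearIndepOn ℝ v (Function.support l) ∧ d = ∑ i, l i • v i := by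
  classical
  set C := (fun l : ι → ℝ => ∑ i, l i • v i) '' signedCoeffs P N with hC
  have hadd : ∀ a ∈ C, ∀ b ∈ C, a + b ∈ C := by
    rintro _ ⟨l, hl, rfl⟩ _ ⟨l', hl', rfl⟩
    exact ⟨l + l', signedCoeffs_add hl hl', by simp [add_smul, Finset.sum_add_distrib]⟩
  have hsmul : ∀ a ∈ C, ∀ r : ℝ, 0 ≤ r → r • a ∈ C := by
    rintro _ ⟨l, hl, rfl⟩ r hr
    exact ⟨r • l, signedCoeffs_smul hl hr, by simp [mul_smul, Finset.smul_sum]⟩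
  have h0 : (0 : E) ∈ C := ⟨0, fun i => by simp, by simp⟩
  have hconv : Convex ℝ C := fun a ha b hb r s hr hs _ =>
    hadd _ (hsmul _ ha _ hr) _ (hsmul _ hb _ hs)
  -- With `p` the projection of `d` to the cone, `d - p` lies in the polar cone and is an admissible
  -- `y`. Then ⟪d, d - p⟫ ≤ 0 ≤ ⟪d - p, p⟫ forces `d = p`.
  obtain ⟨p, hp, hvar, -⟩ := exists_nearest ⟨0, h0⟩ (isClosed_image_signedCoeffs v) hconv d
  have hle : ∀ w ∈ C, ⟪d - p, w⟫ ≤ 0 := fun w hw => by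
    simpa using hvar (w + p) (hadd _ hw _ hp)
  have hpp : 0 ≤ ⟪d - p, p⟫ := by
    have := hvar 0 h0
    rw [zero_sub, inner_neg_right] at this
    linarith
  have hgen : ∀ (i : ι) (r : ℝ), (0 < r → i ∈ P) → (r < 0 → i ∈ N) → r • v i ∈ C := by
    intro i r h1 h2
    refine ⟨Pi.single i r, fun k => ?_, ?_⟩
    · by_cases hk : k = i
      · subst hk; simpa using ⟨h1, h2⟩
      · simp [hk]
    · simp [Pi.single_apply, ite_smul]
  have hd := h (d - p)
    (fun i hi => by
      have := hle _ (hgen i 1 (fun _ => hi) (fun h => absurd h (by norm_num)))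
      rwa [one_smul, real_inner_comm] at this)
    (fun i hi => by
      have := hle _ (hgen i (-1) (fun h => absurd h (by norm_num)) (fun _ => hi))
      rw [neg_smul, one_smul, real_inner_comm, inner_neg_left] at this
      linarith)
  have hz : d - p = 0 := by
    rw [← real_inner_self_nonpos]
    have e : ⟪d - p, d - p⟫ = ⟪d, d - p⟫ - ⟪d - p, p⟫ := by
      rw [inner_sub_left d p, real_inner_comm p (d - p)]
    show ⟪d - p, d - p⟫ ≤ 0
    linarith
  rw [sub_eq_zero] at hz
  obtain ⟨l, hl, hlp⟩ := hp
  obtain ⟨l', h1, h2, h3⟩ := exists_linearIndepOn_support (v := v) hl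
  exact ⟨l', h1, h2, by rw [h3, hz]; exact hlp.symm⟩

/-- The normal cone of a polyhedron at a point is generated by the active constraints. -/
lemma exists_normal_combination {v : ι → E} {U V : Set ι} {lo hi : ι → ℝ} {p d : E}
    (hp : p ∈ polyhedron v U V lo hi)
    (hd : ∀ z ∈ polyhedron v U V lo hi, ⟪d, z - p⟫ ≤ 0) :
    ∃ l : ι → ℝ, LinearIndepOn ℝ v (Function.support l) ∧ d = ∑ i, l i • v i ∧
      (∀ i, 0 < l i → i ∈ U ∧ ⟪v i, p⟫ = hi i) ∧ (∀ i, l i < 0 → i ∈ V ∧ ⟪v i, p⟫ = lo i) := by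
  suffices h : ∀ y, (∀ i ∈ {i | i ∈ U ∧ ⟪v i, p⟫ = hi i}, ⟪v i, y⟫ ≤ 0) →
      (∀ i ∈ {i | i ∈ V ∧ ⟪v i, p⟫ = lo i}, 0 ≤ ⟪v i, y⟫) → ⟪d, y⟫ ≤ 0 by
    obtain ⟨l, hl, hli, hsum⟩ := farkas v d h
    exact ⟨l, hli, hsum, fun i => (hl i).1, fun i => (hl i).2⟩
  intro y hyP hyN
  -- For small ε > 0 the point `p + ε • y` stays in the polyhedron: inactive constraints by
  -- continuity, active ones by the sign conditions on `y`.
  have hcont : ∀ i, Filter.Tendsto (fun ε : ℝ => ⟪v i, p + ε • y⟫) (nhdsWithin 0 (Set.Ioi 0))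
      (nhds ⟪v i, p⟫) := fun i => by
    have : Continuous fun ε : ℝ => ⟪v i, p + ε • y⟫ := by fun_prop
    have h := this.tendsto 0
    simp only [zero_smul, add_zero] at h
    exact h.mono_left nhdsWithin_le_nhds
  have hpos : ∀ᶠ ε : ℝ in nhdsWithin 0 (Set.Ioi 0), 0 < ε := self_mem_nhdsWithin
  have hU : ∀ᶠ ε : ℝ in nhdsWithin 0 (Set.Ioi 0), ∀ i, i ∈ U → ⟪v i, p + ε • y⟫ ≤ hi i := by
    rw [Filter.eventually_all]
    intro i
    by_cases hi' : i ∈ U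
    · rcases (hp.1 i hi').lt_or_eq with hlt | heq
      · filter_upwards [(hcont i).eventually_lt_const hlt] with ε hε _ using hε.le
      · filter_upwards [hpos] with ε hε _
        rw [inner_add_right, inner_smul_right, heq]
        have := mul_nonpos_of_nonneg_of_nonpos hε.le (hyP i ⟨hi', heq⟩)
        linarith
    · exact Filter.Eventually.of_forall fun ε h => absurd h hi'
  have hV : ∀ᶠ ε : ℝ in nhdsWithin 0 (Set.Ioi 0), ∀ i, i ∈ V → lo i ≤ ⟪v i, p + ε • y⟫ := by
    rw [Filter.eventually_all]
    intro i
    by_cases hi' : i ∈ V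
    · rcases (hp.2 i hi').lt_or_eq with hlt | heq
      · filter_upwards [(hcont i).eventually_const_lt hlt] with ε hε _ using hε.le
      · filter_upwards [hpos] with ε hε _
        rw [inner_add_right, inner_smul_right, ← heq]
        have := mul_nonneg hε.le (hyN i ⟨hi', heq.symm⟩)
        linarith
    · exact Filter.Eventually.of_forall fun ε h => absurd h hi'
  obtain ⟨ε, hε, h1, h2⟩ := (hpos.and (hU.and hV)).exists
  have := hd (p + ε • y) ⟨h1, h2⟩
  rw [add_sub_cancel_left, inner_smul_right] at this
  by_contra hcon
  exact absurd this (not_le.2 (mul_pos hε (not_le.1 hcon)))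

end Farkas

/-! ### Coordinates in bases of unit vectors and matrix columns -/

section UnitColumns

variable {p q : ℕ} (M : Matrix (Fin p) (Fin q) ℝ)

/-- The unit vectors of `ℝ^p` together with the columns of `M`. -/
noncomputable def unitsAndColumns : Fin p ⊕ Fin q → EuclideanSpace ℝ (Fin p) :=
  Sum.elim (fun i => EuclideanSpace.single i 1) (fun k => WithLp.toLp 2 fun i => M i k)

lemma unitsAndColumns_sum_apply (f : Fin p ⊕ Fin q → ℝ) (i : Fin p) :
    (∑ l, f l • unitsAndColumns M l) i =
      f (Sum.inl i) + M.mulVec (f ∘ Sum.inr) i := by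
  simp [unitsAndColumns, Fintype.sum_sum_type, Matrix.mulVec, dotProduct, mul_comm]
  simp [Pi.single_apply]

variable {M}

lemma LinearIndepOn.eq_of_sum_eq {ι E : Type*} [Fintype ι] [AddCommGroup E] [Module ℝ E]
    {v : ι → E} {s : Set ι} (h : LinearIndepOn ℝ v s) {f g : ι → ℝ}
    (hf : Function.support f ⊆ s) (hg : Function.support g ⊆ s)
    (hfg : ∑ i, f i • v i = ∑ i, g i • v i) : f = g := by
  rw [← sub_eq_zero]
  refine linearIndepOn_iff_forall_support.1 h _
    ((Function.support_sub f g).trans (Set.union_subset hf hg)) ?_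
  simp [sub_smul, Finset.sum_sub_distrib, hfg]

/-- Extending by unit vectors until all of them are spanned makes `b` index a basis; `T i` holds the
coordinates of the `i`-th unit vector in it. -/
lemma exists_extension_units {s : Set (Fin p ⊕ Fin q)}
    (hs : LinearIndepOn ℝ (unitsAndColumns M) s) :
    ∃ b, s ⊆ b ∧ LinearIndepOn ℝ (unitsAndColumns M) b ∧
      ∃ T : Fin p → Fin p ⊕ Fin q → ℝ, ∀ i, Function.support (T i) ⊆ b ∧
        ∑ l, T i l • unitsAndColumns M l = EuclideanSpace.single i 1 := by
  classical
  obtain ⟨b, -, hsb, hspan, hb⟩ := exists_linearIndepOn_extension hs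
    (Set.subset_union_right (s := Set.range Sum.inl))
  refine ⟨b, hsb, hb, ?_⟩
  · have : ∀ i : Fin p, ∃ f : Fin p ⊕ Fin q → ℝ, Function.support f ⊆ b ∧
        ∑ l, f l • unitsAndColumns M l = EuclideanSpace.single i 1 := by
      intro i
      have hmem := hspan ⟨Sum.inl i, Or.inl ⟨i, rfl⟩, rfl⟩
      rw [SetLike.mem_coe, Finsupp.mem_span_image_iff_linearCombination] at hmem
      obtain ⟨l, hl, hsum⟩ := hmem
      refine ⟨l, fun j hj => ?_, ?_⟩
      · exact hl (by simpa using hj)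
      · rw [Finsupp.linearCombination_apply, Finsupp.sum_fintype _ _ (by simp)] at hsum
        exact hsum
    choose T hT using this
    exact ⟨T, hT⟩

variable {b : Set (Fin p ⊕ Fin q)} (hb : LinearIndepOn ℝ (unitsAndColumns M) b)
  {T : Fin p → Fin p ⊕ Fin q → ℝ}
  (hT : ∀ i, Function.support (T i) ⊆ b ∧
    ∑ l, T i l • unitsAndColumns M l = EuclideanSpace.single i 1)

include hb hT

lemma coeff_eq_sum {f : Fin p ⊕ Fin q → ℝ} (hf : Function.support f ⊆ b) (l : Fin p ⊕ Fin q) :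
    f l = ∑ i, (∑ l, f l • unitsAndColumns M l) i * T i l := by
  have h : f = fun l => ∑ i, (∑ l, f l • unitsAndColumns M l) i * T i l := by
    refine hb.eq_of_sum_eq hf (fun l hl => ?_) ?_
    · by_contra hlb
      refine hl (Finset.sum_eq_zero fun i _ => ?_)
      have : T i l = 0 := by
        by_contra hne
        exact hlb ((hT i).1 hne)
      rw [this, mul_zero]
    · generalize (∑ l, f l • unitsAndColumns M l) = d
      simp only [Finset.sum_smul, mul_smul]
      rw [Finset.sum_comm]
      simp only [← Finset.smul_sum, (hT _).2]
      ext j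
      simp [Pi.single_apply]
  exact congrFun h l

lemma coeff_unit {i : Fin p} (hi : Sum.inl i ∈ b) : T i = Pi.single (Sum.inl i) 1 := by
  classical
  refine hb.eq_of_sum_eq (hT i).1 (fun l hl => ?_) ?_
  · by_cases h : l = Sum.inl i
    · rwa [h]
    · simp [h] at hl
  · rw [(hT i).2]
    simp [Pi.single_apply, ite_smul, unitsAndColumns]

lemma abs_coeff_le_of_abs_coord_le {κ : ℝ} {k : Fin q} (hκ : ∀ i, |T i (Sum.inr k)| ≤ κ)
    {f : Fin p ⊕ Fin q → ℝ} (hf : Function.support f ⊆ b) :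
    |f (Sum.inr k)| ≤ κ * ∑ i, |(∑ l, f l • unitsAndColumns M l) i| := by
  rw [coeff_eq_sum hb hT hf, Finset.mul_sum]
  refine (Finset.abs_sum_le_sum_abs _ _).trans (Finset.sum_le_sum fun i _ => ?_)
  rw [abs_mul, mul_comm]
  exact mul_le_mul_of_nonneg_right (hκ i) (abs_nonneg _)

/-- If the `i`-th unit vector is outside the basis, expanding it gives its fundamental circuit. With
y the column part of `T i`, the vector (y, M y) has entry 1 at `i` and is otherwise supported on the
basis, so independence of the basis makes it elementary. -/
lemma abs_coord_le_kappaX (i : Fin p) (k : Fin q) : |T i (Sum.inr k)| ≤ kappaX M := by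
  have hκ := one_le_kappaX (A := M)
  by_cases hi : Sum.inl i ∈ b
  · rw [coeff_unit hb hT hi]
    simp
    linarith
  have : Nonempty (Fin p) := ⟨i⟩
  have hcoord : ∀ i', T i (Sum.inl i') + M.mulVec (T i ∘ Sum.inr) i' = if i' = i then 1 else 0 :=
    fun i' => by
      rw [← unitsAndColumns_sum_apply, (hT i).2]
      simp
  have hTi : T i (Sum.inl i) = 0 := by
    by_contra hne
    exact hi ((hT i).1 hne)
  have hi1 : M.mulVec (T i ∘ Sum.inr) i = 1 := by
    have := hcoord i
    rwa [hTi, zero_add, if_pos rfl] at this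
  refine abs_le_kappaX (y := T i ∘ Sum.inr) (i := Sum.inr i) hi1 (fun z hz1 hz2 hz3 => ?_)
    (Sum.inl k)
  have hf : (Sum.elim (-(M.mulVec z)) z : Fin p ⊕ Fin q → ℝ) = 0 := by
    refine linearIndepOn_iff_forall_support.1 hb _ ?_ ?_
    · rintro (j | j) hj
      · refine (hT i).1 fun h0 => hj ?_
        have hji : j ≠ i := by
          rintro rfl
          exact hj (by simpa using hz3)
        have := hcoord j
        rw [h0, zero_add, if_neg hji] at this
        simp [hz2 j this]
      · exact (hT i).1 fun h0 => hj (hz1 j h0)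
    · ext j
      rw [unitsAndColumns_sum_apply]
      simp [Sum.elim_comp_inr]
  ext j
  exact congrFun hf (Sum.inr j)

/-- The dual statement, through the fundamental cocircuit: y = `fun i => T i (Sum.inr k)` represents
the coordinate functional of column `k`, so (y, Mᵀ y) vanishes at all other basis elements and is 1
at `k`. It is determined by these values because the basis spans. Taking `M` to be Aᵀ gives κ(𝒳_A)
without comparing κ of a space and of its orthogonal complement. -/
lemma abs_coord_le_kappaX_transpose {k : Fin q} (hk : Sum.inr k ∈ b) (i : Fin p) :
    |T i (Sum.inr k)| ≤ kappaX M.transpose := by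
  classical
  have : Nonempty (Fin q) := ⟨k⟩
  have hcol : ∀ k', Sum.inr k' ∈ b →
      M.transpose.mulVec (fun i => T i (Sum.inr k)) k' = if k = k' then 1 else 0 := by
    intro k' hk'
    have h := coeff_eq_sum hb hT (f := Pi.single (Sum.inr k') 1) (fun l hl => by
      by_cases h : l = Sum.inr k'
      · rwa [h]
      · simp [h] at hl) (Sum.inr k)
    have hs : ∑ l, (Pi.single (Sum.inr k') 1 : Fin p ⊕ Fin q → ℝ) l • unitsAndColumns M l =
        unitsAndColumns M (Sum.inr k') := by
      simp [Pi.single_apply, ite_smul]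
    rw [hs] at h
    simp only [Pi.single_apply, Sum.inr.injEq, unitsAndColumns, Sum.elim_inr] at h
    rw [h]
    rfl
  have hi1 := hcol k hk
  rw [if_pos rfl] at hi1
  refine abs_le_kappaX (A := M.transpose) (y := fun i => T i (Sum.inr k)) (i := Sum.inr k) hi1
    (fun z hz1 hz2 hz3 => ?_) (Sum.inl i)
  have hzb : ∀ l ∈ b, ⟪WithLp.toLp 2 z, unitsAndColumns M l⟫ = 0 := by
    rintro (j | j) hl
    · have : T j (Sum.inr k) = 0 := by rw [coeff_unit hb hT hl]; simp
      simp [unitsAndColumns, hz1 j this, EuclideanSpace.inner_single_right]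
    · have h0 : M.transpose.mulVec z j = 0 := by
        by_cases hj : j = k
        · rw [hj]; exact hz3
        · exact hz2 j (by rw [hcol j hl, if_neg (Ne.symm hj)])
      rw [← h0]
      simp [unitsAndColumns, PiLp.inner_apply, Matrix.mulVec, dotProduct]
  ext j
  have hj : z j = ⟪WithLp.toLp 2 z, EuclideanSpace.single j 1⟫ := by
    simp [EuclideanSpace.inner_single_right]
  rw [hj, ← (hT j).2, inner_sum]
  refine Finset.sum_eq_zero fun l _ => ?_
  rw [inner_smul_right]
  by_cases hl : l ∈ b
  · rw [hzb l hl, mul_zero]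
  · have : T j l = 0 := by
      by_contra hne
      exact hl ((hT j).1 hne)
    rw [this, zero_mul]

omit hb hT

lemma abs_coeff_le_kappaX {f : Fin p ⊕ Fin q → ℝ}
    (hf : LinearIndepOn ℝ (unitsAndColumns M) (Function.support f)) (k : Fin q) :
    |f (Sum.inr k)| ≤ kappaX M * ∑ i, |(∑ l, f l • unitsAndColumns M l) i| := by
  obtain ⟨b, hsb, hb, T, hT⟩ := exists_extension_units hf
  exact abs_coeff_le_of_abs_coord_le hb hT (fun i => abs_coord_le_kappaX hb hT i k) hsb

lemma abs_coeff_le_kappaX_transpose {f : Fin p ⊕ Fin q → ℝ}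
    (hf : LinearIndepOn ℝ (unitsAndColumns M) (Function.support f)) (k : Fin q) :
    |f (Sum.inr k)| ≤ kappaX M.transpose * ∑ i, |(∑ l, f l • unitsAndColumns M l) i| := by
  by_cases hk : f (Sum.inr k) = 0
  · rw [hk, abs_zero]
    exact mul_nonneg (zero_le_one.trans one_le_kappaX)
      (Finset.sum_nonneg fun i _ => abs_nonneg _)
  obtain ⟨b, hsb, hb, T, hT⟩ := exists_extension_units hf
  exact abs_coeff_le_of_abs_coord_le hb hT
    (fun i => abs_coord_le_kappaX_transpose hb hT (hsb hk) i) hsb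

/-- At most `p` coefficients are nonzero by independence in ℝ^p, and each is at most κ‖d‖₁ ≤ κ√p‖d‖₂
for the sum d. This is the source of the constant mκ in the quadratic growth. -/
lemma sum_sq_coeff_le {f : Fin p ⊕ Fin q → ℝ}
    (hf : LinearIndepOn ℝ (unitsAndColumns M) (Function.support f)) :
    ∑ k, f (Sum.inr k) ^ 2 ≤
      (p * kappaX M) ^ 2 * ‖∑ l, f l • unitsAndColumns M l‖ ^ 2 := by
  classical
  set d := ∑ l, f l • unitsAndColumns M l with hd
  have hcard : (Finset.univ.filter fun k => f (Sum.inr k) ≠ 0).card ≤ p := by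
    have h1 : LinearIndependent ℝ fun l : Function.support f => unitsAndColumns M l := hf
    have h2 := h1.fintype_card_le_finrank
    rw [finrank_euclideanSpace_fin] at h2
    refine le_trans ?_ h2
    rw [← Fintype.card_subtype]
    exact Fintype.card_le_of_injective
      (fun k : {k // f (Sum.inr k) ≠ 0} => (⟨Sum.inr k.1, k.2⟩ : Function.support f))
      fun k k' h => Subtype.ext (Sum.inr_injective (congrArg Subtype.val h))
  have hbound : ∀ k, f (Sum.inr k) ^ 2 ≤ kappaX M ^ 2 * (p * ‖d‖ ^ 2) := fun k => by
    have h1 := abs_coeff_le_kappaX hf k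
    rw [← hd] at h1
    have h2 : (∑ i, |d i|) ^ 2 ≤ p * ‖d‖ ^ 2 := by
      have := sq_sum_le_card_mul_sum_sq (s := Finset.univ) (f := fun i => |d i|)
      rw [EuclideanSpace.norm_sq_eq]
      simpa using this
    calc f (Sum.inr k) ^ 2 = |f (Sum.inr k)| ^ 2 := (sq_abs _).symm
      _ ≤ (kappaX M * ∑ i, |d i|) ^ 2 := by gcongr
      _ = kappaX M ^ 2 * (∑ i, |d i|) ^ 2 := by ring
      _ ≤ _ := by gcongr
  calc ∑ k, f (Sum.inr k) ^ 2 = ∑ k with f (Sum.inr k) ≠ 0, f (Sum.inr k) ^ 2 := by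
        rw [Finset.sum_filter]
        refine Finset.sum_congr rfl fun k _ => ?_
        split_ifs with h
        · rfl
        · simp [not_not.1 h]
    _ ≤ ∑ k with f (Sum.inr k) ≠ 0, kappaX M ^ 2 * (p * ‖d‖ ^ 2) :=
        Finset.sum_le_sum fun k _ => hbound k
    _ = (Finset.univ.filter fun k => f (Sum.inr k) ≠ 0).card * (kappaX M ^ 2 * (p * ‖d‖ ^ 2)) := by
        rw [Finset.sum_const, nsmul_eq_mul]
    _ ≤ p * (kappaX M ^ 2 * (p * ‖d‖ ^ 2)) := by
        have : ((Finset.univ.filter fun k => f (Sum.inr k) ≠ 0).card : ℝ) ≤ p := by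
          exact_mod_cast hcard
        gcongr
    _ = _ := by ring

end UnitColumns

/-! ### The fast gradient method and its restarts -/

section NearestPoint

variable {E : Type*} [NormedAddCommGroup E] [InnerProductSpace ℝ E] [CompleteSpace E]
  {X : Set E}

lemma nearestPoint_spec (hne : X.Nonempty) (hc : IsClosed X) (hX : Convex ℝ X) (y : E) :
    nearestPoint X y ∈ X ∧ ∀ w ∈ X, ⟪y - nearestPoint X y, w - nearestPoint X y⟫ ≤ 0 := by
  obtain ⟨p, hp, -, hmin⟩ := exists_nearest hne hc hX y
  obtain ⟨h1, h2⟩ : nearestPoint X y ∈ X ∧ ∀ q ∈ X, ‖y - nearestPoint X y‖ ≤ ‖y - q‖ :=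
    Classical.epsilon_spec (p := fun p => p ∈ X ∧ ∀ q ∈ X, ‖y - p‖ ≤ ‖y - q‖) ⟨p, hp, hmin⟩
  refine ⟨h1, (norm_eq_iInf_iff_real_inner_le_zero hX h1).1 ?_⟩
  have : Nonempty X := hne.to_subtype
  exact le_antisymm (le_ciInf fun w => h2 w w.2)
    (ciInf_le ⟨0, Set.forall_mem_range.2 fun _ => norm_nonneg _⟩ (⟨_, h1⟩ : X))

end NearestPoint

section FastGradientMethod

variable {E : Type*} [NormedAddCommGroup E] [InnerProductSpace ℝ E] [CompleteSpace E]
  {f : E → ℝ} {X : Set E} {L : ℝ}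

/-- `f` is convex and its gradient is `L`-Lipschitz, in the form used by gradient methods. -/
structure IsConvexSmooth (f : E → ℝ) (L : ℝ) : Prop where
  lower : ∀ y z, f z + ⟪gradient f z, y - z⟫ ≤ f y
  upper : ∀ y z, f y ≤ f z + ⟪gradient f z, y - z⟫ + L / 2 * ‖y - z‖ ^ 2

/-- Two-sided bounds by a linear function determine the gradient. -/
lemma isConvexSmooth_of_bounds {G : E → E} (lower : ∀ y z, f z + ⟪G z, y - z⟫ ≤ f y)
    (upper : ∀ y z, f y ≤ f z + ⟪G z, y - z⟫ + L / 2 * ‖y - z‖ ^ 2) : IsConvexSmooth f L := by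
  have hG : gradient f = G := by
    refine gradient_eq fun z => ?_
    rw [hasGradientAt_iff_isLittleO]
    refine Asymptotics.IsBigO.trans_isLittleO (g := fun y => ‖y - z‖ ^ 2) ?_ ?_
    · refine Asymptotics.IsBigO.of_bound (|L / 2|) (Filter.Eventually.of_forall fun y => ?_)
      have h1 := lower y z
      have h2 := upper y z
      rw [Real.norm_eq_abs, Real.norm_eq_abs, abs_of_nonneg (by linarith),
        abs_of_nonneg (sq_nonneg ‖y - z‖)]
      have h3 := mul_le_mul_of_nonneg_right (le_abs_self (L / 2)) (sq_nonneg ‖y - z‖)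
      linarith
    · exact Asymptotics.isLittleO_pow_sub_sub z one_lt_two
  exact ⟨by rwa [hG], by rwa [hG]⟩

variable (hf : IsConvexSmooth f L) (hL : 0 < L) (hne : X.Nonempty) (hc : IsClosed X)
  (hX : Convex ℝ X)

include hf hL hne hc hX

/-- Adds the convexity bound at `z`, the smoothness bound at `p` and `L` times the variational
inequality of the projection. -/
lemma projected_gradient_step (y : E) {z : E} (hz : z ∈ X) :
    let p := nearestPoint X (y - (1 / L) • gradient f y)
    f p + L / 2 * ‖p - y‖ ^ 2 + L * ⟪y - z, p - y⟫ ≤ f z := by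
  intro p
  have h1 := (nearestPoint_spec hne hc hX (y - (1 / L) • gradient f y)).2 z hz
  have h2 := hf.lower z y
  have h3 := hf.upper p y
  change ⟪y - (1 / L) • gradient f y - p, z - p⟫ ≤ 0 at h1
  have e1 : y - (1 / L) • gradient f y - p = -(p - y) - (1 / L) • gradient f y := by abel
  have e2 : z - p = (z - y) - (p - y) := by abel
  have e4 : y - z = -(z - y) := by abel
  rw [e1, inner_sub_left (-(p - y)), real_inner_smul_left, e2, inner_sub_right _ (z - y),
    inner_sub_right _ (z - y), inner_neg_left, inner_neg_left, real_inner_self_eq_norm_sq] at h1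
  have h4 := mul_le_mul_of_nonneg_left h1 hL.le
  rw [e4, inner_neg_left, real_inner_comm (p - y) (z - y)]
  have e5 : L * (-⟪p - y, z - y⟫ - -‖p - y‖ ^ 2 -
      1 / L * (⟪gradient f y, z - y⟫ - ⟪gradient f y, p - y⟫)) =
      -(L * ⟪p - y, z - y⟫) + L * ‖p - y‖ ^ 2 -
        (⟪gradient f y, z - y⟫ - ⟪gradient f y, p - y⟫) := by
    field_simp
    ring
  rw [e5, mul_zero] at h4
  linarith

/-- The Lyapunov function of accelerated gradient descent. The step inequality is used at `s.x` with
weight t - 1 and at `z` with weight 1, scaled by 2t/L; the recursion t'² - t' = t² and the choice of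
momentum make the sum telescope. -/
lemma fgmStep_potential_le {s : FGMState E} (ht : 1 ≤ s.t) (hs : s.x ∈ X) {z : E} (hz : z ∈ X) :
    let s' := fgmStep f X L s
    2 / L * (s'.t ^ 2 - s'.t) * (f s'.x - f z) + ‖s'.t • s'.y - (s'.t - 1) • s'.x - z‖ ^ 2 ≤
      2 / L * (s.t ^ 2 - s.t) * (f s.x - f z) + ‖s.t • s.y - (s.t - 1) • s.x - z‖ ^ 2 := by
  intro s'
  set p := nearestPoint X (s.y - (1 / L) • gradient f s.y) with hp
  set t' := (1 + Real.sqrt (1 + 4 * s.t ^ 2)) / 2 with ht'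
  have hx' : s'.x = p := rfl
  have htt : s'.t = t' := rfl
  have hy' : s'.y = p + ((s.t - 1) / t') • (p - s.x) := rfl
  have hsq : Real.sqrt (1 + 4 * s.t ^ 2) ^ 2 = 1 + 4 * s.t ^ 2 := Real.sq_sqrt (by positivity)
  have ht'0 : 0 < t' := by
    have := Real.sqrt_nonneg (1 + 4 * s.t ^ 2)
    rw [ht']; linarith
  have hquad : t' ^ 2 - t' = s.t ^ 2 := by
    rw [ht']
    linear_combination hsq / 4
  have hU : t' • (p + ((s.t - 1) / t') • (p - s.x)) - (t' - 1) • p - z =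
      (s.t • s.y - (s.t - 1) • s.x - z) + s.t • (p - s.y) := by
    rw [smul_add, smul_smul, mul_div_cancel₀ _ ht'0.ne']
    module
  rw [hx', htt, hy', hquad, hU, norm_add_sq_real]
  have h1 := projected_gradient_step hf hL hne hc hX s.y hs
  have h2 := projected_gradient_step hf hL hne hc hX s.y hz
  simp only [← hp] at h1 h2
  have h3 := mul_le_mul_of_nonneg_left h1 (sub_nonneg.2 ht)
  have h4 := mul_le_mul_of_nonneg_left (add_le_add h3 h2) (mul_nonneg (div_nonneg zero_le_two hL.le)
    (zero_le_one.trans ht))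
  have e : ⟪s.t • s.y - (s.t - 1) • s.x - z, s.t • (p - s.y)⟫ =
      s.t * ((s.t - 1) * ⟪s.y - s.x, p - s.y⟫ + ⟪s.y - z, p - s.y⟫) := by
    have : s.t • s.y - (s.t - 1) • s.x - z = (s.t - 1) • (s.y - s.x) + (s.y - z) := by module
    rw [this, inner_add_left, real_inner_smul_left, real_inner_smul_right, real_inner_smul_right]
    ring
  rw [e, norm_smul, mul_pow, Real.norm_eq_abs, sq_abs]
  have e2 : 2 / L * s.t * ((s.t - 1) * (f p + L / 2 * ‖p - s.y‖ ^ 2 + L * ⟪s.y - s.x, p - s.y⟫) +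
      (f p + L / 2 * ‖p - s.y‖ ^ 2 + L * ⟪s.y - z, p - s.y⟫)) =
      2 / L * s.t ^ 2 * f p + s.t ^ 2 * ‖p - s.y‖ ^ 2 +
      2 * (s.t * ((s.t - 1) * ⟪s.y - s.x, p - s.y⟫ + ⟪s.y - z, p - s.y⟫)) := by
    field_simp
    ring
  rw [e2] at h4
  have e3 : 2 / L * s.t * ((s.t - 1) * f s.x + f z) =
    2 / L * (s.t ^ 2 - s.t) * (f s.x - f z) + 2 / L * s.t ^ 2 * f z := by ring
  rw [e3] at h4
  linarith

lemma fgm_invariant {x₀ z : E} (hx₀ : x₀ ∈ X) (hz : z ∈ X) (k : ℕ) :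
    let s := (fgmStep f X L)^[k] { x := x₀, y := x₀, t := 1 }
    1 + (k : ℝ) / 2 ≤ s.t ∧ s.x ∈ X ∧
      2 / L * (s.t ^ 2 - s.t) * (f s.x - f z) + ‖s.t • s.y - (s.t - 1) • s.x - z‖ ^ 2 ≤
        ‖x₀ - z‖ ^ 2 := by
  induction k with
  | zero => simp [hx₀]
  | succ k ih =>
    rw [Function.iterate_succ_apply']
    set s := (fgmStep f X L)^[k] { x := x₀, y := x₀, t := 1 }
    obtain ⟨h1, h2, h3⟩ := ih
    have hk : (0 : ℝ) ≤ k := Nat.cast_nonneg k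
    refine ⟨?_, (nearestPoint_spec hne hc hX _).1,
      (fgmStep_potential_le hf hL hne hc hX (by linarith) h2 hz).trans h3⟩
    have hsqrt : 2 * s.t ≤ Real.sqrt (1 + 4 * s.t ^ 2) :=
      Real.le_sqrt_of_sq_le (by linarith [sq_nonneg s.t])
    change 1 + ((k + 1 : ℕ) : ℝ) / 2 ≤ (1 + Real.sqrt (1 + 4 * s.t ^ 2)) / 2
    push_cast
    linarith

lemma fgm_mem {x₀ : E} (hx₀ : x₀ ∈ X) (k : ℕ) : fgm f X L x₀ k ∈ X :=
  (fgm_invariant hf hL hne hc hX hx₀ hx₀ k).2.1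

/-- The `O(1/k²)` convergence rate of the fast gradient method. -/
lemma fgm_rate {x₀ z : E} (hx₀ : x₀ ∈ X) (hz : z ∈ X) (hmin : ∀ w ∈ X, f z ≤ f w) (k : ℕ) :
    k ^ 2 * (f (fgm f X L x₀ k) - f z) ≤ 2 * L * ‖x₀ - z‖ ^ 2 := by
  obtain ⟨h1, h2, h3⟩ := fgm_invariant hf hL hne hc hX hx₀ hz k
  change _ * (f (((fgmStep f X L)^[k] { x := x₀, y := x₀, t := 1 }).x) - f z) ≤ _
  set s := (fgmStep f X L)^[k] { x := x₀, y := x₀, t := 1 }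
  have hv : 0 ≤ f s.x - f z := sub_nonneg.2 (hmin _ h2)
  have hk : (0 : ℝ) ≤ k := Nat.cast_nonneg k
  -- From t ≥ 1 + k/2: t(t - 1) ≥ (1 + k/2)(k/2).
  have ht : (k : ℝ) ^ 2 / 4 ≤ s.t ^ 2 - s.t := by nlinarith
  have h4 : 2 / L * (s.t ^ 2 - s.t) * (f s.x - f z) ≤ ‖x₀ - z‖ ^ 2 := by
    linarith [sq_nonneg ‖s.t • s.y - (s.t - 1) • s.x - z‖]
  have h5 : 2 / L * ((k : ℝ) ^ 2 / 4) * (f s.x - f z) ≤ ‖x₀ - z‖ ^ 2 :=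
    le_trans (by gcongr) h4
  have h6 := mul_le_mul_of_nonneg_left h5 (mul_nonneg zero_le_two hL.le)
  refine le_trans (le_of_eq ?_) h6
  field_simp
  norm_num

/-- Linear convergence of the restarted fast gradient method under quadratic growth. -/
lemma restarted_fgm_rate {R : ℝ} {h : ℕ} (hR : 0 < R) (hf0 : ∀ w, 0 ≤ f w)
    (hgrowth : ∀ w ∈ X, ∃ z ∈ X, f z = 0 ∧ ‖w - z‖ ^ 2 ≤ R ^ 2 * (2 * f w))
    (hh : (2 * Real.exp 1 * R) ^ 2 * L ≤ (h : ℝ) ^ 2) {x₀ : E} (hx₀ : x₀ ∈ X) (T : ℕ) :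
    (fun z => fgm f X L z h)^[T] x₀ ∈ X ∧
      f ((fun z => fgm f X L z h)^[T] x₀) ≤ Real.exp (-2) ^ T * f x₀ := by
  induction T with
  | zero => simpa using hx₀
  | succ T ih =>
    rw [Function.iterate_succ_apply']
    set w := (fun z => fgm f X L z h)^[T] x₀
    refine ⟨fgm_mem hf hL hne hc hX ih.1 h, ?_⟩
    -- The minimizer to compare with is chosen anew in each round, so growth away from the set of
    -- minimizers suffices.
    obtain ⟨z, hz, hz0, hd⟩ := hgrowth w ih.1
    have h1 := fgm_rate hf hL hne hc hX ih.1 hz (fun v _ => hz0 ▸ hf0 v) h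
    rw [hz0, sub_zero] at h1
    have hpos : 0 < (2 * Real.exp 1 * R) ^ 2 * L := by positivity
    have hexp : Real.exp 1 ^ 2 * Real.exp (-2) = 1 := by
      rw [← Real.exp_nat_mul, ← Real.exp_add]; norm_num
    -- The rate and the growth bound give h² f(new) ≤ 4LR² f(w), so h ≥ 2eR√L gains exactly the
    -- factor e^(-2).
    have h2 : (h : ℝ) ^ 2 * f (fgm f X L w h) ≤ (h : ℝ) ^ 2 * (Real.exp (-2) * f w) :=
      calc (h : ℝ) ^ 2 * f (fgm f X L w h) ≤ 2 * L * (R ^ 2 * (2 * f w)) :=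
            h1.trans (mul_le_mul_of_nonneg_left hd (by positivity))
        _ = (2 * Real.exp 1 * R) ^ 2 * L * (Real.exp (-2) * f w) := by
            linear_combination (-4 * L * R ^ 2 * f w) * hexp
        _ ≤ _ := mul_le_mul_of_nonneg_right hh (mul_nonneg (Real.exp_pos _).le (hf0 _))
    have h3 := le_of_mul_le_mul_left h2 (lt_of_lt_of_le hpos hh)
    calc f (fgm f X L w h) ≤ Real.exp (-2) * f w := h3
      _ ≤ Real.exp (-2) * (Real.exp (-2) ^ T * f x₀) :=
          mul_le_mul_of_nonneg_left ih.2 (Real.exp_pos _).le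
      _ = _ := by ring

end FastGradientMethod

/-! ### Excess over a cap -/

section CapExcess

variable {D a b : ℝ}

lemma capExcess_nonneg (D a s : ℝ) : 0 ≤ capExcess D a s := by
  unfold capExcess
  split_ifs
  · exact le_rfl
  · exact le_max_left _ _

lemma capExcess_le (hD : 0 ≤ D) (ha : 0 ≤ a) (s : ℝ) : capExcess D a s ≤ max 0 s := by
  unfold capExcess
  split_ifs
  · exact le_max_left _ _
  · exact max_le_max le_rfl (by linarith [div_nonneg hD ha])

lemma sub_div_le_capExcess (ha : a ≠ 0) (s : ℝ) : s - D / a ≤ capExcess D a s := by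
  rw [capExcess, if_neg ha]
  exact le_max_right _ _

lemma mul_le_add_capExcess_mul (hD : 0 ≤ D) (ha : 0 ≤ a) (s : ℝ) :
    s * a ≤ D + capExcess D a s * a := by
  rcases ha.eq_or_lt with rfl | ha'
  · simpa using hD
  · have h := mul_le_mul_of_nonneg_right (sub_div_le_capExcess (D := D) ha'.ne' s) ha
    rw [sub_mul, div_mul_cancel₀ _ ha'.ne'] at h
    linarith

lemma capExcess_eq_zero (ha : 0 ≤ a) {s : ℝ} (h : s * a ≤ D) : capExcess D a s = 0 := by
  unfold capExcess
  split_ifs with h0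
  · rfl
  · have ha' : 0 < a := lt_of_le_of_ne ha (Ne.symm h0)
    exact max_eq_left (by linarith [(le_div_iff₀ ha').2 h])

lemma capExcess_lower (s t : ℝ) :
    1 / 2 * capExcess D a s ^ 2 + capExcess D a s * (t - s) ≤ 1 / 2 * capExcess D a t ^ 2 := by
  unfold capExcess
  split_ifs
  · simp
  · rcases max_cases 0 (s - D / a) with ⟨h1, h2⟩ | ⟨h1, h2⟩ <;>
      rcases max_cases 0 (t - D / a) with ⟨h3, h4⟩ | ⟨h3, h4⟩ <;> rw [h1, h3] <;>
      nlinarith [sq_nonneg (t - s), sq_nonneg (t - D / a)]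

/-- The caps are nonnegative, so the excesses of `s` and `-s` are never both positive. Hence the two
squares together have curvature 1, not 2, which is why L = ‖A‖₂² suffices. -/
lemma capExcess_upper (hD : 0 ≤ D) (ha : 0 ≤ a) (hb : 0 ≤ b) (s t : ℝ) :
    1 / 2 * (capExcess D a t ^ 2 + capExcess D b (-t) ^ 2) ≤
      1 / 2 * (capExcess D a s ^ 2 + capExcess D b (-s) ^ 2) +
        (capExcess D a s - capExcess D b (-s)) * (t - s) + 1 / 2 * (t - s) ^ 2 := by
  have h1 : 0 ≤ D / a := div_nonneg hD ha
  have h2 : 0 ≤ D / b := div_nonneg hD hb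
  unfold capExcess
  generalize D / a = α at *
  generalize D / b = β at *
  have key : ∀ s t : ℝ, 1 / 2 * max 0 (t - α) ^ 2 ≤ 1 / 2 * max 0 (s - α) ^ 2 +
      max 0 (s - α) * (t - s) + 1 / 2 * (t - s) ^ 2 := by
    intro s t
    rcases max_cases 0 (s - α) with ⟨h1, h2⟩ | ⟨h1, h2⟩ <;>
      rcases max_cases 0 (t - α) with ⟨h3, h4⟩ | ⟨h3, h4⟩ <;> rw [h1, h3] <;>
      nlinarith [sq_nonneg (t - α)]
  split_ifs
  · nlinarith [sq_nonneg (t - s)]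
  · rcases max_cases 0 (-s - β) with ⟨h1, h2⟩ | ⟨h1, h2⟩ <;>
      rcases max_cases 0 (-t - β) with ⟨h3, h4⟩ | ⟨h3, h4⟩ <;> rw [h1, h3] <;>
      nlinarith [sq_nonneg (t + β)]
  · have := key s t
    linarith
  · rcases max_cases 0 (s - α) with ⟨h1, h2⟩ | ⟨h1, h2⟩ <;>
      rcases max_cases 0 (t - α) with ⟨h3, h4⟩ | ⟨h3, h4⟩ <;>
      rcases max_cases 0 (-s - β) with ⟨h5, h6⟩ | ⟨h5, h6⟩ <;>
      rcases max_cases 0 (-t - β) with ⟨h7, h8⟩ | ⟨h7, h8⟩ <;> rw [h1, h3, h5, h7] <;>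
      nlinarith [sq_nonneg (t - α), sq_nonneg (t + β)]

end CapExcess

/-! ### The spectral norm -/

section SpectralNorm

variable {m n : ℕ} (A : Matrix (Fin m) (Fin n) ℝ)

lemma spectralNorm₂_nonneg : 0 ≤ spectralNorm₂ A := norm_nonneg _

lemma norm_mulVec_le (v : Fin n → ℝ) :
    ‖WithLp.toLp 2 (A.mulVec v)‖ ≤ spectralNorm₂ A * ‖WithLp.toLp 2 v‖ :=
  (LinearMap.toContinuousLinearMap (Matrix.toEuclideanLin A)).le_opNorm (WithLp.toLp 2 v)

lemma inner_toLp {k : ℕ} (v w : Fin k → ℝ) :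
    ⟪WithLp.toLp 2 v, WithLp.toLp 2 w⟫ = v ⬝ᵥ w := by
  simp [PiLp.inner_apply, dotProduct, mul_comm]

lemma norm_transpose_mulVec_le (w : Fin m → ℝ) :
    ‖WithLp.toLp 2 (A.transpose.mulVec w)‖ ≤ spectralNorm₂ A * ‖WithLp.toLp 2 w‖ := by
  set v := A.transpose.mulVec w with hv
  rcases (norm_nonneg (WithLp.toLp 2 v)).eq_or_lt with h0 | hpos
  · rw [← h0]
    exact mul_nonneg (spectralNorm₂_nonneg A) (norm_nonneg _)
  refine le_of_mul_le_mul_right ?_ hpos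
  calc ‖WithLp.toLp 2 v‖ * ‖WithLp.toLp 2 v‖ = ⟪WithLp.toLp 2 v, WithLp.toLp 2 v⟫ :=
        (real_inner_self_eq_norm_mul_norm _).symm
    _ = ⟪WithLp.toLp 2 (A.mulVec v), WithLp.toLp 2 w⟫ := by
        rw [inner_toLp, inner_toLp, dotProduct_comm (A.mulVec v), Matrix.dotProduct_mulVec w,
          ← Matrix.mulVec_transpose A w]
    _ ≤ ‖WithLp.toLp 2 (A.mulVec v)‖ * ‖WithLp.toLp 2 w‖ := real_inner_le_norm _ _
    _ ≤ spectralNorm₂ A * ‖WithLp.toLp 2 v‖ * ‖WithLp.toLp 2 w‖ := by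
        gcongr
        exact norm_mulVec_le A v
    _ = _ := by ring

lemma norm_toLp_sq {k : ℕ} (v : Fin k → ℝ) : ‖WithLp.toLp 2 v‖ ^ 2 = ∑ i, v i ^ 2 := by
  rw [EuclideanSpace.norm_sq_eq]
  simp

lemma sum_abs_le_sqrt_mul_spectralNorm₂ (j : Fin n) :
    ∑ i, |A i j| ≤ Real.sqrt m * spectralNorm₂ A := by
  have h1 := norm_mulVec_le A (Pi.single j 1)
  have hn : ‖WithLp.toLp 2 (Pi.single j 1 : Fin n → ℝ)‖ = 1 := by simp
  rw [hn, mul_one] at h1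
  have h2 : (∑ i, |A i j|) ^ 2 ≤ m * ‖WithLp.toLp 2 (A.mulVec (Pi.single j 1))‖ ^ 2 := by
    have := sq_sum_le_card_mul_sum_sq (s := Finset.univ) (f := fun i => |A i j|)
    rw [norm_toLp_sq]
    simpa using this
  refine abs_le_of_sq_le_sq' ?_ (mul_nonneg (Real.sqrt_nonneg _) (spectralNorm₂_nonneg A)) |>.2
  rw [mul_pow, Real.sq_sqrt (Nat.cast_nonneg m)]
  exact h2.trans (by gcongr)

/-- A column has ℓ₁ norm at most √m times its Euclidean norm. The bound makes L positive and later
absorbs the rounding of the restart length. -/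
lemma one_le_mul_spectralNorm₂ (hA : 1 ≤ matrixL1Norm A) : 1 ≤ m * spectralNorm₂ A := by
  have h1 : matrixL1Norm A ≤ Real.sqrt m * spectralNorm₂ A := by
    refine Real.iSup_le (sum_abs_le_sqrt_mul_spectralNorm₂ A)
      (mul_nonneg (Real.sqrt_nonneg _) (spectralNorm₂_nonneg A))
  have h2 : Real.sqrt m ≤ m := by
    rcases Nat.eq_zero_or_pos m with rfl | hm
    · simp
    · have hm' : (1 : ℝ) ≤ m := by exact_mod_cast hm
      exact Real.sqrt_le_iff.2 ⟨by linarith, by nlinarith⟩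
  exact (hA.trans h1).trans (mul_le_mul_of_nonneg_right h2 (spectralNorm₂_nonneg A))

end SpectralNorm

/-! ### Smoothness of the dual objective and its domain -/

section DualObjective

variable {m n : ℕ} {A : Matrix (Fin m) (Fin n) ℝ} {b : Fin m → ℝ} {c u x : Fin n → ℝ} {δ : ℝ}

lemma l1Norm_nonneg {k : ℕ} (v : Fin k → ℝ) : 0 ≤ l1Norm v :=
  Finset.sum_nonneg fun _ _ => abs_nonneg _

lemma dualObjective_nonneg (π : EuclideanSpace ℝ (Fin m)) : 0 ≤ dualObjective A c u x δ π :=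
  mul_nonneg (by norm_num) (Finset.sum_nonneg fun _ _ => by positivity)

lemma isConvexSmooth_dualObjective (hδ : 0 ≤ δ) (hx : x ∈ Set.Icc 0 u) :
    IsConvexSmooth (dualObjective A c u x δ) (spectralNorm₂ A ^ 2) := by
  have hD : 0 ≤ 2 * δ * ‖c‖ := by positivity
  set D := 2 * δ * ‖c‖ with hDdef
  let s : EuclideanSpace ℝ (Fin m) → Fin n → ℝ := fun π => c - A.transpose.mulVec π.ofLp
  -- The derivative of the objective in the slack `s`; the gradient in π is then `-A r`.
  let r : EuclideanSpace ℝ (Fin m) → Fin n → ℝ := fun π i =>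
    capExcess D (x i) (s π i) - capExcess D (u i - x i) (-s π i)
  have hG : ∀ y z, ⟪WithLp.toLp 2 (-A.mulVec (r z)), y - z⟫ =
      ∑ i, r z i * (s y i - s z i) := fun y z => by
    have h1 : ⟪WithLp.toLp 2 (-A.mulVec (r z)), y - z⟫ = -A.mulVec (r z) ⬝ᵥ (y - z).ofLp :=
      inner_toLp _ (y - z).ofLp
    have h2 : s y - s z = -A.transpose.mulVec (y - z).ofLp := by
      simp only [s, WithLp.ofLp_sub, Matrix.mulVec_sub]
      abel
    calc _ = -(r z ⬝ᵥ A.transpose.mulVec (y - z).ofLp) := by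
          rw [h1, neg_dotProduct, dotProduct_comm (A.mulVec (r z)), Matrix.dotProduct_mulVec,
            ← Matrix.mulVec_transpose, dotProduct_comm]
      _ = r z ⬝ᵥ (s y - s z) := by rw [h2, dotProduct_neg]
      _ = _ := rfl
  have hobj : ∀ π, dualObjective A c u x δ π = ∑ i, 1 / 2 *
      (capExcess D (x i) (s π i) ^ 2 + capExcess D (u i - x i) (-s π i) ^ 2) := fun π => by
    rw [dualObjective, Finset.mul_sum]
  refine isConvexSmooth_of_bounds (G := fun z => WithLp.toLp 2 (-A.mulVec (r z)))
    (fun y z => ?_) (fun y z => ?_)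
  · rw [hG, hobj, hobj, ← Finset.sum_add_distrib]
    refine Finset.sum_le_sum fun i _ => ?_
    have h1 := capExcess_lower (D := D) (a := x i) (s z i) (s y i)
    have h2 := capExcess_lower (D := D) (a := u i - x i) (-s z i) (-s y i)
    simp only [r]
    linarith
  · have hsq : ∑ i, (s y i - s z i) ^ 2 ≤ spectralNorm₂ A ^ 2 * ‖y - z‖ ^ 2 := by
      have h1 := norm_transpose_mulVec_le A (y - z).ofLp
      have h2 : ∑ i, (s y i - s z i) ^ 2 =
          ‖WithLp.toLp 2 (A.transpose.mulVec (y - z).ofLp)‖ ^ 2 := by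
        rw [norm_toLp_sq]
        refine Finset.sum_congr rfl fun i _ => ?_
        simp only [s, WithLp.ofLp_sub, Matrix.mulVec_sub, Pi.sub_apply]
        ring
      rw [h2, ← mul_pow]
      exact pow_le_pow_left₀ (norm_nonneg _) h1 2
    have hsum : ∑ i, 1 / 2 *
        (capExcess D (x i) (s y i) ^ 2 + capExcess D (u i - x i) (-s y i) ^ 2) ≤
        ∑ i, (1 / 2 * (capExcess D (x i) (s z i) ^ 2 + capExcess D (u i - x i) (-s z i) ^ 2) +
          r z i * (s y i - s z i) + 1 / 2 * (s y i - s z i) ^ 2) :=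
      Finset.sum_le_sum fun i _ =>
        capExcess_upper hD (hx.1 i) (sub_nonneg.2 (hx.2 i)) (s z i) (s y i)
    rw [hG, hobj, hobj]
    rw [Finset.sum_add_distrib, Finset.sum_add_distrib, ← Finset.mul_sum] at hsum
    rw [← Finset.mul_sum] at hsum ⊢
    rw [← Finset.mul_sum] at hsum ⊢
    linarith

lemma convex_dualDomain : Convex ℝ (dualDomain A b c x δ) := by
  intro π hπ π' hπ' p q hp hq hpq j
  have h1 := mul_le_mul_of_nonneg_left (hπ j) hp
  have h2 := mul_le_mul_of_nonneg_left (hπ' j) hq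
  have h3 : |(p • π + q • π') j| ≤ p * |π j| + q * |π' j| := by
    refine (abs_add_le _ _).trans (le_of_eq ?_)
    simp [abs_mul, abs_of_nonneg hp, abs_of_nonneg hq]
  have h4 := mul_le_mul_of_nonneg_right h3 (l1Norm_nonneg (A.mulVec x - b))
  have h5 : p * (2 * δ * ‖c‖) + q * (2 * δ * ‖c‖) = 2 * δ * ‖c‖ := by
    rw [← add_mul, hpq, one_mul]
  linarith

lemma isClosed_dualDomain : IsClosed (dualDomain A b c x δ) := by
  have : dualDomain A b c x δ =
      ⋂ j, {π | |π j| * l1Norm (A.mulVec x - b) ≤ 2 * δ * ‖c‖} := by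
    ext π; simp [dualDomain]
  rw [this]
  exact isClosed_iInter fun j => isClosed_le (by fun_prop) continuous_const

lemma zero_mem_dualDomain (hδ : 0 ≤ δ) : 0 ∈ dualDomain A b c x δ := fun j => by
  simp only [PiLp.zero_apply, abs_zero, zero_mul]
  positivity

end DualObjective

/-! ### Bounded dual solutions and zeros of the dual objective -/

section DualSolution

variable {m n : ℕ} {A : Matrix (Fin m) (Fin n) ℝ} {b : Fin m → ℝ} {c u x : Fin n → ℝ} {δ : ℝ}

lemma inner_unitsAndColumns_inl {p q : ℕ} (M : Matrix (Fin p) (Fin q) ℝ) (i : Fin p)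
    (z : EuclideanSpace ℝ (Fin p)) : ⟪unitsAndColumns M (Sum.inl i), z⟫ = z i := by
  simp [unitsAndColumns, EuclideanSpace.inner_single_left]

lemma inner_unitsAndColumns_inr {p q : ℕ} (M : Matrix (Fin p) (Fin q) ℝ) (k : Fin q)
    (z : EuclideanSpace ℝ (Fin p)) :
    ⟪unitsAndColumns M (Sum.inr k), z⟫ = M.transpose.mulVec z.ofLp k :=
  inner_toLp (fun i => M i k) z.ofLp

lemma feasibleRegion_exists_min (h : (feasibleRegion A b u).Nonempty) :
    ∃ y ∈ feasibleRegion A b u, ∀ z ∈ feasibleRegion A b u, c ⬝ᵥ y ≤ c ⬝ᵥ z := by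
  have hclosed : IsClosed {x : Fin n → ℝ | A.mulVec x = b} :=
    isClosed_eq (by fun_prop) continuous_const
  have hcomp : IsCompact (feasibleRegion A b u) := isCompact_Icc.inter_left hclosed
  exact hcomp.exists_isMinOn h (f := fun x => c ⬝ᵥ x) (by fun_prop)

/-- Optimal solutions of the program have dual solutions with entries at most `n κ ‖c‖`. -/
lemma exists_dual_of_min {y : Fin n → ℝ} (hy : y ∈ feasibleRegion A b u)
    (hmin : ∀ z ∈ feasibleRegion A b u, c ⬝ᵥ y ≤ c ⬝ᵥ z) :
    ∃ π : Fin m → ℝ, (∀ j, |π j| ≤ n * kappaX A * ‖c‖) ∧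
      (∀ i, 0 < (c - A.transpose.mulVec π) i → y i = 0) ∧
      ∀ i, (c - A.transpose.mulVec π) i < 0 → y i = u i := by
  -- Columns of Aᵀ are rows of A; the equations are encoded by equal lower and upper bounds `b`.
  set P := polyhedron (unitsAndColumns A.transpose) Set.univ Set.univ (Sum.elim 0 b)
    (Sum.elim u b) with hPdef
  have hP : ∀ z : EuclideanSpace ℝ (Fin n), z ∈ P ↔ z.ofLp ∈ feasibleRegion A b u := by
    intro z
    simp only [hPdef, polyhedron, Set.mem_univ, true_imp_iff, Sum.forall,
      inner_unitsAndColumns_inl, inner_unitsAndColumns_inr, Sum.elim_inl, Sum.elim_inr,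
      Matrix.transpose_transpose, feasibleRegion, Set.mem_Icc, Pi.le_def, Set.mem_ofPred_eq,
      funext_iff]
    constructor
    · rintro ⟨⟨h1, h2⟩, h3, h4⟩
      exact ⟨fun j => le_antisymm (h2 j) (h4 j), h3, h1⟩
    · rintro ⟨h1, h2, h3⟩
      exact ⟨⟨h3, fun j => (h1 j).le⟩, h2, fun j => (h1 j).ge⟩
  -- Optimality puts -c in the normal cone at `y`. The negated multipliers of the rows form π, and
  -- those of the bounds the slack, so the sign of a slack names the active bound.
  obtain ⟨l, hli, hsum, hpos, hneg⟩ := exists_normal_combination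
    (v := unitsAndColumns A.transpose) (U := Set.univ) (V := Set.univ) (lo := Sum.elim 0 b)
    (hi := Sum.elim u b) (p := WithLp.toLp 2 y) (d := WithLp.toLp 2 (-c)) ((hP _).2 hy)
    (fun z hz => by
      have h1 := hmin _ ((hP z).1 hz)
      have h2 : ⟪WithLp.toLp 2 (-c), z - WithLp.toLp 2 y⟫ = -c ⬝ᵥ (z.ofLp - y) :=
        inner_toLp (-c) (z.ofLp - y)
      rw [h2, neg_dotProduct, dotProduct_sub]
      linarith)
  have hslack : ∀ i, (c - A.transpose.mulVec (-(l ∘ Sum.inr))) i = -l (Sum.inl i) := fun i => by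
    have h := unitsAndColumns_sum_apply A.transpose l i
    rw [← hsum] at h
    simp only [Matrix.mulVec_neg, Pi.sub_apply, Pi.neg_apply] at h ⊢
    linarith
  refine ⟨-(l ∘ Sum.inr), fun j => ?_, fun i hi => ?_, fun i hi => ?_⟩
  · have h := abs_coeff_le_kappaX_transpose hli j
    rw [← hsum, Matrix.transpose_transpose] at h
    have h2 : ∑ i, |(WithLp.toLp 2 (-c) : EuclideanSpace ℝ (Fin n)) i| ≤ n * ‖c‖ := by
      calc _ ≤ ∑ _i : Fin n, ‖c‖ := Finset.sum_le_sum fun i _ => by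
            simpa using norm_le_pi_norm c i
        _ = n * ‖c‖ := by simp
    calc |(-(l ∘ Sum.inr)) j| = |l (Sum.inr j)| := by simp
      _ ≤ kappaX A * (n * ‖c‖) :=
          h.trans (mul_le_mul_of_nonneg_left h2 (zero_le_one.trans one_le_kappaX))
      _ = _ := by ring
  · rw [hslack] at hi
    have h := (hneg (Sum.inl i) (by linarith)).2
    rwa [inner_unitsAndColumns_inl] at h
  · rw [hslack] at hi
    have h := (hpos (Sum.inl i) (by linarith)).2
    rwa [inner_unitsAndColumns_inl] at h

/-- The dual vectors at which the dual objective vanishes on the dual domain. -/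
def dualZeros {m n : ℕ} (A : Matrix (Fin m) (Fin n) ℝ) (b : Fin m → ℝ) (c u x : Fin n → ℝ)
    (δ : ℝ) : Set (EuclideanSpace ℝ (Fin m)) :=
  {π | π ∈ dualDomain A b c x δ ∧
    ∀ i, (c - A.transpose.mulVec π.ofLp) i * x i ≤ 2 * δ * ‖c‖ ∧
      -(c - A.transpose.mulVec π.ofLp) i * (u i - x i) ≤ 2 * δ * ‖c‖}

lemma dualObjective_eq_zero (hx : x ∈ Set.Icc 0 u) {π : EuclideanSpace ℝ (Fin m)}
    (hπ : π ∈ dualZeros A b c u x δ) : dualObjective A c u x δ π = 0 := by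
  rw [dualObjective, Finset.sum_eq_zero, mul_zero]
  intro i _
  rw [capExcess_eq_zero (hx.1 i) (hπ.2 i).1,
    capExcess_eq_zero (sub_nonneg.2 (hx.2 i)) (hπ.2 i).2]
  norm_num

/-- For an optimal pair (y, π) with slack s, ⟨c, x - y⟩ = Σ sᵢ(xᵢ - yᵢ) + ⟨π, Ax - b⟩. The left side
is at most δ‖c‖, and the last term at least -δ‖c‖ by the bound on π. By complementary slackness the
summands are nonnegative and equal to sᵢxᵢ or -sᵢ(uᵢ - xᵢ), so each is at most 2δ‖c‖: hence the 2 in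
the definition of a certificate. -/
lemma dualZeros_nonempty {δf : ℝ} (hδ : 0 ≤ δ)
    (hδf : δf * n * kappaX A * matrixL1Norm A ≤ δ)
    (hfeas : IsDeltaFeasible A b u δf x) (hopt : IsDeltaOptimal A b c u δ x) :
    (dualZeros A b c u x δ).Nonempty := by
  obtain ⟨hx, hres⟩ := hfeas
  obtain ⟨y, hy, hmin⟩ := feasibleRegion_exists_min (c := c) hopt.1
  obtain ⟨π, hπ, hs0, hsu⟩ := exists_dual_of_min hy hmin
  set ρ := l1Norm (A.mulVec x - b) with hρ
  have hρ0 : 0 ≤ ρ := l1Norm_nonneg _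
  have hκ : 1 ≤ kappaX A := one_le_kappaX
  have hπρ : ∀ j, |π j| * ρ ≤ δ * ‖c‖ := fun j => by
    calc |π j| * ρ ≤ n * kappaX A * ‖c‖ * ρ := mul_le_mul_of_nonneg_right (hπ j) hρ0
      _ ≤ n * kappaX A * ‖c‖ * (δf * matrixL1Norm A) := by gcongr
      _ = δf * n * kappaX A * matrixL1Norm A * ‖c‖ := by ring
      _ ≤ δ * ‖c‖ := by gcongr
  have hΦ : optValue A b c u ≤ c ⬝ᵥ y :=
    csInf_le ⟨c ⬝ᵥ y, by rintro _ ⟨z, hz, rfl⟩; exact hmin z hz⟩ ⟨y, hy, rfl⟩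
  have hgap : c ⬝ᵥ x - c ⬝ᵥ y ≤ δ * ‖c‖ := by linarith [hopt.2]
  set s := c - A.transpose.mulVec π with hs
  have hsplit : c ⬝ᵥ x - c ⬝ᵥ y = ∑ i, s i * (x i - y i) + π ⬝ᵥ (A.mulVec x - b) := by
    have h1 : π ⬝ᵥ (A.mulVec x - b) = A.transpose.mulVec π ⬝ᵥ (x - y) := by
      rw [← hy.1, ← Matrix.mulVec_sub, Matrix.dotProduct_mulVec, Matrix.mulVec_transpose]
    have h2 : ∑ i, s i * (x i - y i) = s ⬝ᵥ (x - y) := rfl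
    rw [h1, h2, ← add_dotProduct, hs, sub_add_cancel, dotProduct_sub]
  have hres' : -(π ⬝ᵥ (A.mulVec x - b)) ≤ δ * ‖c‖ := by
    rcases Nat.eq_zero_or_pos m with rfl | hm
    · simp [dotProduct]
      positivity
    have hmax : ∃ j, ∀ k, |π k| ≤ |π j| := by
      have : Nonempty (Fin m) := ⟨⟨0, hm⟩⟩
      obtain ⟨j, hj⟩ := Finite.exists_max fun k => |π k|
      exact ⟨j, hj⟩
    obtain ⟨j, hj⟩ := hmax
    calc -(π ⬝ᵥ (A.mulVec x - b)) ≤ |π ⬝ᵥ (A.mulVec x - b)| := neg_le_abs _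
      _ ≤ ∑ k, |π k * (A.mulVec x - b) k| := Finset.abs_sum_le_sum_abs _ _
      _ ≤ ∑ k, |π j| * |(A.mulVec x - b) k| := Finset.sum_le_sum fun k _ => by
          rw [abs_mul]
          exact mul_le_mul_of_nonneg_right (hj k) (abs_nonneg _)
      _ = |π j| * ρ := by rw [← Finset.mul_sum, hρ, l1Norm]
      _ ≤ δ * ‖c‖ := hπρ j
  have hterm : ∀ i, 0 ≤ s i * (x i - y i) ∧ s i * x i ≤ max 0 (s i * (x i - y i)) ∧
      -s i * (u i - x i) ≤ max 0 (s i * (x i - y i)) := fun i => by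
    have hx0 : 0 ≤ x i := hx.1 i
    have hxu : 0 ≤ u i - x i := sub_nonneg.2 (hx.2 i)
    rcases lt_trichotomy (s i) 0 with h | h | h
    · rw [hsu i h]
      refine ⟨?_, le_max_of_le_left ?_, le_max_of_le_right ?_⟩ <;> nlinarith
    · simp [h]
    · rw [hs0 i h]
      refine ⟨?_, le_max_of_le_right ?_, le_max_of_le_left ?_⟩ <;> nlinarith
  have hle : ∀ i, s i * (x i - y i) ≤ 2 * δ * ‖c‖ := fun i => by
    have := Finset.single_le_sum (f := fun i => s i * (x i - y i)) (fun i _ => (hterm i).1)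
      (Finset.mem_univ i)
    linarith
  have hD : 0 ≤ 2 * δ * ‖c‖ := by positivity
  refine ⟨WithLp.toLp 2 π, fun j => ?_, fun i => ⟨?_, ?_⟩⟩
  · refine (hπρ j).trans ?_
    nlinarith [mul_nonneg hδ (norm_nonneg c)]
  · exact (hterm i).2.1.trans (max_le hD (hle i))
  · exact (hterm i).2.2.trans (max_le hD (hle i))

end DualSolution

/-! ### Quadratic growth -/

section QuadraticGrowth

variable {m n : ℕ} {A : Matrix (Fin m) (Fin n) ℝ} {b : Fin m → ℝ} {c u x : Fin n → ℝ} {δ : ℝ}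

/-- Quadratic growth of the dual objective, a Hoffman-type bound with the constant `m κ`. -/
lemma dualObjective_quadratic_growth (hδ : 0 ≤ δ) (hx : x ∈ Set.Icc 0 u)
    (hne : (dualZeros A b c u x δ).Nonempty) {π : EuclideanSpace ℝ (Fin m)}
    (hπ : π ∈ dualDomain A b c x δ) :
    ∃ z ∈ dualDomain A b c x δ, dualObjective A c u x δ z = 0 ∧
      ‖π - z‖ ^ 2 ≤ (m * kappaX A) ^ 2 * (2 * dualObjective A c u x δ π) := by
  have hD : 0 ≤ 2 * δ * ‖c‖ := by positivity
  set D := 2 * δ * ‖c‖ with hDdef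
  set ρ := l1Norm (A.mulVec x - b) with hρdef
  have hρ : 0 ≤ ρ := l1Norm_nonneg _
  have hxu : ∀ i, 0 ≤ u i - x i := fun i => sub_nonneg.2 (hx.2 i)
  let v := unitsAndColumns A
  -- The zero set is a polyhedron with the unit vectors (box) and the columns of A (slacks) as
  -- normals; `U` and `V` leave out the bounds with denominator 0.
  let U : Set (Fin m ⊕ Fin n) := {k | Sum.elim (fun _ => ρ) (fun i => u i - x i) k ≠ 0}
  let V : Set (Fin m ⊕ Fin n) := {k | Sum.elim (fun _ => ρ) x k ≠ 0}
  let hi : Fin m ⊕ Fin n → ℝ := Sum.elim (fun _ => D / ρ) fun i => c i + D / (u i - x i)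
  let lo : Fin m ⊕ Fin n → ℝ := Sum.elim (fun _ => -(D / ρ)) fun i => c i - D / x i
  have hbox : ∀ w : EuclideanSpace ℝ (Fin m), w ∈ dualDomain A b c x δ ↔
      ρ ≠ 0 → ∀ j, w j ≤ D / ρ ∧ -(D / ρ) ≤ w j := by
    intro w
    constructor
    · intro hw h0 j
      have hpos : 0 < ρ := lt_of_le_of_ne hρ (Ne.symm h0)
      have := abs_le.1 ((le_div_iff₀ hpos).2 (hw j))
      exact ⟨this.2, this.1⟩
    · intro h j
      change |w j| * ρ ≤ D
      rcases hρ.eq_or_lt with h0 | hpos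
      · rw [← h0, mul_zero]; exact hD
      · rw [← le_div_iff₀ hpos]
        exact abs_le.2 (h hpos.ne' j).symm
  have hcap : ∀ {a : ℝ}, 0 ≤ a → ∀ t, (t * a ≤ D ↔ (a ≠ 0 → t ≤ D / a)) := by
    intro a ha t
    rcases ha.eq_or_lt with rfl | hpos
    · simpa using hD
    · simp [hpos.ne', le_div_iff₀ hpos]
  have hP : ∀ w, w ∈ polyhedron v U V lo hi ↔ w ∈ dualZeros A b c u x δ := by
    intro w
    rw [dualZeros, Set.mem_ofPred_eq, hbox]
    simp only [polyhedron, Set.mem_ofPred_eq, Sum.forall, v, U, V, lo, hi, Sum.elim_inl,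
      Sum.elim_inr, inner_unitsAndColumns_inl, inner_unitsAndColumns_inr, hcap (hx.1 _),
      hcap (hxu _), Pi.sub_apply, ← hDdef]
    constructor
    · rintro ⟨⟨h1, h2⟩, h3, h4⟩
      exact ⟨fun h0 j => ⟨h1 j h0, h3 j h0⟩, fun i =>
        ⟨fun h => by linarith [h4 i h], fun h => by linarith [h2 i h]⟩⟩
    · rintro ⟨h1, h2⟩
      exact ⟨⟨fun j h0 => (h1 h0 j).1, fun i h => by linarith [(h2 i).2 h]⟩,
        fun j h0 => (h1 h0 j).2, fun i h => by linarith [(h2 i).1 h]⟩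
  obtain ⟨p, hp, hvar, -⟩ := exists_nearest (K := polyhedron v U V lo hi)
    (hne.imp fun w hw => (hP w).2 hw) (isClosed_polyhedron v U V lo hi)
    (convex_polyhedron v U V lo hi) π
  obtain ⟨l, hli, hsum, hpos, hneg⟩ := exists_normal_combination hp hvar
  have hpz := (hP p).1 hp
  refine ⟨p, hpz.1, dualObjective_eq_zero hx hpz, ?_⟩
  let s : Fin n → ℝ := c - A.transpose.mulVec π.ofLp
  let e : Fin n → ℝ := fun i =>
    Real.sqrt (capExcess D (x i) (s i) ^ 2 + capExcess D (u i - x i) (-s i) ^ 2)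
  have he1 : ∀ i, capExcess D (x i) (s i) ≤ e i := fun i =>
    Real.le_sqrt_of_sq_le (by linarith [sq_nonneg (capExcess D (u i - x i) (-s i))])
  have he2 : ∀ i, capExcess D (u i - x i) (-s i) ≤ e i := fun i =>
    Real.le_sqrt_of_sq_le (by linarith [sq_nonneg (capExcess D (x i) (s i))])
  have hesum : ∑ i, e i ^ 2 = 2 * dualObjective A c u x δ π := by
    rw [dualObjective, ← mul_assoc]
    rw [show (2 : ℝ) * (1 / 2) = 1 by norm_num, one_mul]
    exact Finset.sum_congr rfl fun i _ => Real.sq_sqrt (by positivity)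
  -- An active box constraint contributes at most 0, since π satisfies it; an active slack
  -- constraint contributes at most its multiplier times the violation at π.
  have hterm : ∀ k, l k * ⟪v k, π - p⟫ ≤
      Sum.elim (fun _ => 0) (fun i => |l (Sum.inr i)| * e i) k := by
    rintro (j | i)
    · rw [inner_sub_right, Sum.elim_inl]
      rcases lt_trichotomy (l (Sum.inl j)) 0 with h | h | h
      · obtain ⟨h1, h2⟩ := hneg _ h
        have h3 := ((hbox π).1 hπ h1 j).2
        rw [h2]
        simp only [v, lo, Sum.elim_inl, inner_unitsAndColumns_inl]
        nlinarith
      · rw [h, zero_mul]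
      · obtain ⟨h1, h2⟩ := hpos _ h
        have h3 := ((hbox π).1 hπ h1 j).1
        rw [h2]
        simp only [v, hi, Sum.elim_inl, inner_unitsAndColumns_inl]
        nlinarith
    · rw [inner_sub_right, Sum.elim_inr]
      have hsi : A.transpose.mulVec π.ofLp i = c i - s i := by simp [s]
      rcases lt_trichotomy (l (Sum.inr i)) 0 with h | h | h
      · obtain ⟨h1, h2⟩ := hneg _ h
        have h3 := (sub_div_le_capExcess (D := D) (show x i ≠ 0 from h1) (s i)).trans (he1 i)
        rw [h2, abs_of_neg h]
        simp only [v, lo, Sum.elim_inr, inner_unitsAndColumns_inr, hsi]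
        nlinarith
      · simp [h]
      · obtain ⟨h1, h2⟩ := hpos _ h
        have h3 := (sub_div_le_capExcess (D := D) (show u i - x i ≠ 0 from h1) (-s i)).trans (he2 i)
        rw [h2, abs_of_pos h]
        simp only [v, hi, Sum.elim_inr, inner_unitsAndColumns_inr, hsi]
        nlinarith
  have hd : ‖π - p‖ ^ 2 ≤ ∑ i, |l (Sum.inr i)| * e i := by
    calc ‖π - p‖ ^ 2 = ⟪∑ k, l k • v k, π - p⟫ := by
          rw [← hsum, real_inner_self_eq_norm_sq]
      _ = ∑ k, l k * ⟪v k, π - p⟫ := by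
          rw [sum_inner]
          simp only [real_inner_smul_left]
      _ ≤ ∑ k, Sum.elim (fun _ => 0) (fun i => |l (Sum.inr i)| * e i) k :=
          Finset.sum_le_sum fun k _ => hterm k
      _ = _ := by simp [Fintype.sum_sum_type]
  have hcoeff := sum_sq_coeff_le hli
  rw [← hsum] at hcoeff
  -- Cauchy–Schwarz with `hcoeff` gives ‖π - p‖⁴ ≤ (mκ)²‖π - p‖²·2f, and one factor ‖π - p‖²
  -- cancels.
  have hcs := Finset.sum_mul_sq_le_sq_mul_sq Finset.univ (fun i => |l (Sum.inr i)|) e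
  simp only [sq_abs] at hcs
  rw [hesum] at hcs
  have hf := dualObjective_nonneg (A := A) (c := c) (u := u) (x := x) (δ := δ) π
  rcases (sq_nonneg ‖π - p‖).eq_or_lt with h0 | hdpos
  · rw [← h0]; positivity
  · refine le_of_mul_le_mul_right ?_ hdpos
    calc ‖π - p‖ ^ 2 * ‖π - p‖ ^ 2 = (‖π - p‖ ^ 2) ^ 2 := by ring
      _ ≤ (∑ i, |l (Sum.inr i)| * e i) ^ 2 := by gcongr
      _ ≤ (∑ i, l (Sum.inr i) ^ 2) * (2 * dualObjective A c u x δ π) := hcs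
      _ ≤ ((m * kappaX A) ^ 2 * ‖π - p‖ ^ 2) * (2 * dualObjective A c u x δ π) := by gcongr
      _ = _ := by ring

end QuadraticGrowth

/-! ### Success of a run and the iteration count -/

section DualCertificate

variable {m n : ℕ} {A : Matrix (Fin m) (Fin n) ℝ} {b : Fin m → ℝ} {c u x : Fin n → ℝ} {δ : ℝ}

lemma isCertificate_of_capExcess_le (hδ : 0 ≤ δ) (hx : x ∈ Set.Icc 0 u)
    {π : EuclideanSpace ℝ (Fin m)} (hπ : π ∈ dualDomain A b c x δ) {ε : ℝ}
    (hε : ε * l1Norm u ≤ 2 * δ * ‖c‖)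
    (h1 : ∀ i, capExcess (2 * δ * ‖c‖) (x i) ((c - A.transpose.mulVec π.ofLp) i) ≤ ε)
    (h2 : ∀ i, capExcess (2 * δ * ‖c‖) (u i - x i) (-(c - A.transpose.mulVec π.ofLp) i) ≤ ε) :
    IsCertificate A b c u x (2 * δ) π.ofLp (dualSlackPlus A c π.ofLp)
      (dualSlackMinus A c π.ofLp) := by
  have hD : 0 ≤ 2 * δ * ‖c‖ := by positivity
  have key : ∀ {i : Fin n} {a s : ℝ}, 0 ≤ a → a ≤ u i → capExcess (2 * δ * ‖c‖) a s ≤ ε →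
      max s 0 * a ≤ 2 * (2 * δ) * ‖c‖ := by
    intro i a s ha hau hc
    have hε0 : 0 ≤ ε := (capExcess_nonneg _ _ _).trans hc
    have hu : u i ≤ l1Norm u := (le_abs_self _).trans
      (Finset.single_le_sum (f := fun i => |u i|) (fun i _ => abs_nonneg _) (Finset.mem_univ i))
    -- The excess adds at most another 2δ‖c‖ to the allowed 2δ‖c‖, which is why the result is a
    -- 2δ-certificate.
    have h3 : capExcess (2 * δ * ‖c‖) a s * a ≤ 2 * δ * ‖c‖ :=
      (mul_le_mul hc (hau.trans hu) ha hε0).trans hε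
    rcases max_cases s 0 with ⟨h, -⟩ | ⟨h, -⟩ <;> rw [h]
    · linarith [mul_le_add_capExcess_mul hD ha s]
    · linarith
  refine ⟨?_, fun i => ⟨le_max_right _ _, ?_⟩, fun i => ⟨le_max_right _ _, ?_⟩, ?_⟩
  · ext i
    simp only [dualSlackPlus, dualSlackMinus, Pi.add_apply, Pi.sub_apply]
    rcases le_total (c i) (A.transpose.mulVec π.ofLp i) with h | h
    · rw [max_eq_right (sub_nonpos.2 h), max_eq_left (sub_nonneg.2 h)]; ring
    · rw [max_eq_left (sub_nonneg.2 h), max_eq_right (sub_nonpos.2 h)]; ring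
  · exact key (hx.1 i) (hx.2 i) (h1 i)
  · have h := h2 i
    rw [Pi.sub_apply, neg_sub] at h
    exact key (sub_nonneg.2 (hx.2 i)) (sub_le_self _ (hx.1 i)) h
  · rcases (l1Norm_nonneg (A.mulVec x - b)).eq_or_lt with h0 | hpos
    · rw [← h0, mul_zero]; linarith
    · have h3 : ‖π.ofLp‖ ≤ 2 * δ * ‖c‖ / l1Norm (A.mulVec x - b) :=
        (pi_norm_le_iff_of_nonneg (by positivity)).2 fun j => (le_div_iff₀ hpos).2 (hπ j)
      linarith [(le_div_iff₀ hpos).1 h3]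

/-- At π = 0 the slack is `c`; caps only reduce it, and only one sign of each entry counts. -/
lemma two_mul_dualObjective_zero_le (hδ : 0 ≤ δ) (hx : x ∈ Set.Icc 0 u) :
    2 * dualObjective A c u x δ 0 ≤ n * ‖c‖ ^ 2 := by
  have hD : 0 ≤ 2 * δ * ‖c‖ := by positivity
  have hterm : ∀ i, capExcess (2 * δ * ‖c‖) (x i) (c i) ^ 2 +
      capExcess (2 * δ * ‖c‖) (u i - x i) (-c i) ^ 2 ≤ ‖c‖ ^ 2 := fun i => by
    have h1 := pow_le_pow_left₀ (capExcess_nonneg _ _ _) (capExcess_le hD (hx.1 i) (c i)) 2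
    have h2 := pow_le_pow_left₀ (capExcess_nonneg _ _ _)
      (capExcess_le hD (sub_nonneg.2 (hx.2 i)) (-c i)) 2
    have h3 : max 0 (c i) ^ 2 + max 0 (-c i) ^ 2 = |c i| ^ 2 := by
      rw [sq_abs]
      rcases le_total 0 (c i) with h | h
      · rw [max_eq_right h, max_eq_left (by linarith)]; ring
      · rw [max_eq_left h, max_eq_right (by linarith)]; ring
    have h4 : |c i| ^ 2 ≤ ‖c‖ ^ 2 := pow_le_pow_left₀ (abs_nonneg _) (norm_le_pi_norm c i) 2
    linarith
  calc 2 * dualObjective A c u x δ 0 = ∑ i, (capExcess (2 * δ * ‖c‖) (x i) (c i) ^ 2 +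
        capExcess (2 * δ * ‖c‖) (u i - x i) (-c i) ^ 2) := by
        simp [dualObjective]
    _ ≤ ∑ _i : Fin n, ‖c‖ ^ 2 := Finset.sum_le_sum fun i _ => hterm i
    _ = n * ‖c‖ ^ 2 := by simp

lemma exp_neg_ceil_log_mul_le {q d : ℝ} (hq : 0 ≤ q) (hd : 0 < d) :
    Real.exp (-(⌈Real.log (q / d)⌉₊ : ℝ)) * q ≤ d := by
  rcases hq.eq_or_lt with rfl | hq
  · simpa using hd.le
  have h1 : q / d ≤ Real.exp ⌈Real.log (q / d)⌉₊ :=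
    (Real.log_le_iff_le_exp (div_pos hq hd)).1 (Nat.le_ceil _)
  rw [Real.exp_neg, inv_mul_le_iff₀ (Real.exp_pos _)]
  rwa [div_le_iff₀ hd] at h1

lemma rfgm_mul {E : Type*} [NormedAddCommGroup E] [InnerProductSpace ℝ E] [CompleteSpace E]
    (f : E → ℝ) (X : Set E) (L : ℝ) {h : ℕ} (hh : 0 < h) (x₀ : E) (T : ℕ) :
    rfgm f X L h x₀ (T * h) = (fun z => fgm f X L z h)^[T] x₀ := by
  rw [rfgm, Nat.mul_div_cancel _ hh, Nat.mul_mod_left]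
  rfl

/-- A run whose guess is at least `κ` succeeds. -/
lemma isCertificate_attempt (hA : 1 ≤ matrixL1Norm A) (hδ : 0 < δ) (hx : x ∈ Set.Icc 0 u)
    (hne : (dualZeros A b c u x δ).Nonempty) {κ : ℝ} (hκ : kappaX A ≤ κ) :
    IsCertificate A b c u x (2 * δ) (attempt A b c u x δ κ)
      (dualSlackPlus A c (attempt A b c u x δ κ)) (dualSlackMinus A c (attempt A b c u x δ κ)) := by
  have hκ1 : 1 ≤ kappaX A := one_le_kappaX
  have hκ0 : 0 < κ := by linarith
  have hmA := one_le_mul_spectralNorm₂ A hA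
  have hA0 : 0 < spectralNorm₂ A := by
    refine lt_of_le_of_ne (spectralNorm₂_nonneg A) fun h => ?_
    rw [← h, mul_zero] at hmA
    linarith
  have hm0 : (0 : ℝ) < m := pos_of_mul_pos_left (by linarith) hA0.le
  set h := restartLength A κ with hdef
  have hle : 2 * Real.exp 1 * (m * κ * spectralNorm₂ A) ≤ h := Nat.le_ceil _
  have hpos : 0 < 2 * Real.exp 1 * (m * κ * spectralNorm₂ A) := by positivity
  have hh0 : 0 < h := by exact_mod_cast hpos.trans_le hle
  set T := ⌈Real.log (Real.sqrt n * l1Norm u / (2 * δ))⌉₊ with hT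
  set f := dualObjective A c u x δ
  have hrate := restarted_fgm_rate (R := m * kappaX A) (h := h)
    (isConvexSmooth_dualObjective (A := A) (c := c) hδ.le hx) (pow_pos hA0 2)
    ⟨0, zero_mem_dualDomain hδ.le⟩ isClosed_dualDomain convex_dualDomain (by positivity)
    dualObjective_nonneg (fun w hw => dualObjective_quadratic_growth hδ.le hx hne hw)
    (by
      rw [← mul_pow]
      refine pow_le_pow_left₀ (by positivity) (le_trans ?_ hle) 2
      have := mul_le_mul_of_nonneg_left hκ
        (by positivity : 0 ≤ 2 * Real.exp 1 * m * spectralNorm₂ A)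
      linarith) (zero_mem_dualDomain (A := A) (b := b) (c := c) (x := x) hδ.le) T
  rw [← rfgm_mul _ _ _ hh0] at hrate
  obtain ⟨hmem, hrate⟩ := hrate
  have hq : 0 ≤ Real.sqrt n * l1Norm u := mul_nonneg (Real.sqrt_nonneg _) (l1Norm_nonneg u)
  have hexp := exp_neg_ceil_log_mul_le hq (by positivity : 0 < 2 * δ)
  rw [← hT] at hexp
  set w := rfgm f (dualDomain A b c x δ) (spectralNorm₂ A ^ 2) h 0 (T * h) with hw
  set ε := Real.exp (-(T : ℝ)) * (Real.sqrt n * ‖c‖) with hε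
  have hε0 : 0 ≤ ε := by positivity
  -- The factor e^(-2) per round becomes e^(-1) for the excesses, being square roots of f.
  have hfw : 2 * f w ≤ ε ^ 2 := by
    have h1 : Real.exp (-2) ^ T = Real.exp (-(T : ℝ)) ^ 2 := by
      rw [← Real.exp_nat_mul, ← Real.exp_nat_mul]
      congr 1
      push_cast
      ring
    calc 2 * f w ≤ Real.exp (-2) ^ T * (2 * f 0) := by linarith
      _ ≤ Real.exp (-2) ^ T * (n * ‖c‖ ^ 2) :=
          mul_le_mul_of_nonneg_left (two_mul_dualObjective_zero_le hδ.le hx) (by positivity)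
      _ = ε ^ 2 := by
          rw [hε, h1, mul_pow, mul_pow, Real.sq_sqrt (Nat.cast_nonneg n)]
  have hsum : ∀ i, capExcess (2 * δ * ‖c‖) (x i) ((c - A.transpose.mulVec w.ofLp) i) ^ 2 +
      capExcess (2 * δ * ‖c‖) (u i - x i) (-(c - A.transpose.mulVec w.ofLp) i) ^ 2 ≤ ε ^ 2 :=
    fun i => by
      refine le_trans ?_ hfw
      have h1 : 2 * f w = ∑ i,
          (capExcess (2 * δ * ‖c‖) (x i) ((c - A.transpose.mulVec w.ofLp) i) ^ 2 +
          capExcess (2 * δ * ‖c‖) (u i - x i) (-(c - A.transpose.mulVec w.ofLp) i) ^ 2) := by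
        simp only [f, dualObjective]
        ring
      rw [h1]
      exact Finset.single_le_sum (f := fun i =>
        (capExcess (2 * δ * ‖c‖) (x i) ((c - A.transpose.mulVec w.ofLp) i) ^ 2 +
          capExcess (2 * δ * ‖c‖) (u i - x i) (-(c - A.transpose.mulVec w.ofLp) i) ^ 2))
        (fun i _ => by positivity) (Finset.mem_univ i)
  have hattempt : attempt A b c u x δ κ = w.ofLp := rfl
  rw [hattempt]
  refine isCertificate_of_capExcess_le hδ.le hx hmem (ε := ε) ?_ (fun i => ?_) (fun i => ?_)
  · calc ε * l1Norm u = Real.exp (-(T : ℝ)) * (Real.sqrt n * l1Norm u) * ‖c‖ := by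
          rw [hε]; ring
      _ ≤ 2 * δ * ‖c‖ := mul_le_mul_of_nonneg_right hexp (norm_nonneg c)
  · refine (abs_le_of_sq_le_sq' ?_ hε0).2
    linarith [hsum i,
      sq_nonneg (capExcess (2 * δ * ‖c‖) (u i - x i) (-(c - A.transpose.mulVec w.ofLp) i))]
  · refine (abs_le_of_sq_le_sq' ?_ hε0).2
    linarith [hsum i,
      sq_nonneg (capExcess (2 * δ * ‖c‖) (x i) ((c - A.transpose.mulVec w.ofLp) i))]

lemma ceil_log_le (hδ : 0 < δ) :
    (⌈Real.log (Real.sqrt n * l1Norm u / (2 * δ))⌉₊ : ℝ) ≤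
      2 * max 0 (Real.log (n * l1Norm u / δ)) := by
  rcases le_or_gt (Real.log (Real.sqrt n * l1Norm u / (2 * δ))) 0 with h | h
  · rw [Nat.ceil_eq_zero.2 h, Nat.cast_zero]
    positivity
  have hq0 : 0 ≤ Real.sqrt n * l1Norm u := mul_nonneg (Real.sqrt_nonneg _) (l1Norm_nonneg u)
  have hq : 0 < Real.sqrt n * l1Norm u := by
    refine lt_of_le_of_ne hq0 fun h0 => ?_
    rw [← h0] at h
    simp at h
  have hn : Real.sqrt n ≤ n := by
    rcases Nat.eq_zero_or_pos n with rfl | hn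
    · simp
    · have hn' : (1 : ℝ) ≤ n := by exact_mod_cast hn
      exact Real.sqrt_le_iff.2 ⟨by linarith, by nlinarith⟩
  -- The 2 in the denominator leaves room log 2; doubling the bound yields 2 log 2 > 1, enough for
  -- rounding up.
  have h1 : Real.log (Real.sqrt n * l1Norm u / (2 * δ)) + Real.log 2 ≤
      Real.log (n * l1Norm u / δ) := by
    rw [← Real.log_mul (by positivity) two_ne_zero]
    refine Real.log_le_log (by positivity) ?_
    have : Real.sqrt n * l1Norm u / (2 * δ) * 2 = Real.sqrt n * l1Norm u / δ := by
      field_simp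
    rw [this]
    have := l1Norm_nonneg u
    gcongr
  have h2 := Nat.ceil_lt_add_one h.le
  have h3 := Real.log_two_gt_d9
  have h4 := le_max_right 0 (Real.log (n * l1Norm u / δ))
  linarith

lemma restartLength_le (hA : 1 ≤ matrixL1Norm A) {κ : ℝ} (hκ : 1 ≤ κ) :
    (restartLength A κ : ℝ) ≤ 7 * (m * spectralNorm₂ A) * κ := by
  have h1 := one_le_mul_spectralNorm₂ A hA
  have h0 := spectralNorm₂_nonneg A
  have h2 : 1 ≤ m * spectralNorm₂ A * κ := one_le_mul_of_one_le_of_one_le h1 hκ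
  have h3 := Nat.ceil_lt_add_one
    (show 0 ≤ 2 * Real.exp 1 * (m * κ * spectralNorm₂ A) by positivity)
  have h4 := Real.exp_one_lt_d9
  change (⌈2 * Real.exp 1 * (m * κ * spectralNorm₂ A)⌉₊ : ℝ) ≤ _
  nlinarith

lemma dualCertificateIterations_le (hA : 1 ≤ matrixL1Norm A) (hδ : 0 < δ)
    (hJ : (2 : ℝ) ^ dualCertificateStop A b c u x δ ≤ 2 * kappaX A) :
    (dualCertificateIterations A b c u x δ : ℝ) ≤
      56 * (m * spectralNorm₂ A * kappaX A * max 0 (Real.log (n * l1Norm u / δ))) := by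
  set ℓ := max 0 (Real.log (n * l1Norm u / δ)) with hℓ
  have hℓ0 : 0 ≤ ℓ := le_max_left _ _
  have h0 : 0 ≤ m * spectralNorm₂ A := mul_nonneg (Nat.cast_nonneg m) (spectralNorm₂_nonneg A)
  set J := dualCertificateStop A b c u x δ
  have hterm : ∀ j, (attemptIterations A u δ (2 ^ j) : ℝ) ≤
      14 * (m * spectralNorm₂ A) * ℓ * 2 ^ j := fun j => by
    have h1 := ceil_log_le (n := n) (u := u) hδ
    have h2 := restartLength_le hA (κ := 2 ^ j) (one_le_pow₀ one_le_two)
    rw [attemptIterations]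
    push_cast
    calc _ ≤ 2 * ℓ * (7 * (m * spectralNorm₂ A) * 2 ^ j) :=
          mul_le_mul h1 h2 (Nat.cast_nonneg _) (by positivity)
      _ = _ := by ring
  -- The sum is 2·2^J - 1 with 2^J ≤ 2κ. Altogether 56 = 2·7·4, from rounds, restart length and
  -- guesses.
  have hgeom : ∑ j ∈ Finset.range (J + 1), (2 : ℝ) ^ j ≤ 4 * kappaX A := by
    have h1 := geom_sum_mul (2 : ℝ) (J + 1)
    rw [pow_succ] at h1
    linarith
  rw [dualCertificateIterations]
  push_cast
  calc _ ≤ ∑ j ∈ Finset.range (J + 1), 14 * (m * spectralNorm₂ A) * ℓ * 2 ^ j :=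
        Finset.sum_le_sum fun j _ => hterm j
    _ = 14 * (m * spectralNorm₂ A) * ℓ * ∑ j ∈ Finset.range (J + 1), (2 : ℝ) ^ j := by
        rw [Finset.mul_sum]
    _ ≤ 14 * (m * spectralNorm₂ A) * ℓ * (4 * kappaX A) := by gcongr
    _ = _ := by ring

lemma exists_pow_two_between {κ : ℝ} (hκ : 1 ≤ κ) : ∃ j : ℕ, κ ≤ 2 ^ j ∧ (2 : ℝ) ^ j ≤ 2 * κ := by
  obtain ⟨j, h1, h2⟩ := exists_nat_pow_near hκ one_lt_two
  exact ⟨j + 1, h2.le, by rw [pow_succ]; linarith⟩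

end DualCertificate

theorem theorem4p7 :
    ∃ C : ℝ, 0 < C ∧
      ∀ (m n : ℕ) (A : Matrix (Fin m) (Fin n) ℝ) (b : Fin m → ℝ) (x c u : Fin n → ℝ)
        (δfeas δopt : ℝ),
        1 ≤ matrixL1Norm A →
        0 < δopt →
        0 ≤ δfeas * n * kappaX A * matrixL1Norm A →
        δfeas * n * kappaX A * matrixL1Norm A ≤ δopt →
        IsDeltaFeasible A b u δfeas x →
        IsDeltaOptimal A b c u δopt x →
        IsCertificate A b c u x (2 * δopt)
            (dualCertificate A b c u x δopt)
            (dualSlackPlus A c (dualCertificate A b c u x δopt))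
            (dualSlackMinus A c (dualCertificate A b c u x δopt)) ∧
          (dualCertificateIterations A b c u x δopt : ℝ) ≤
            C * (m * spectralNorm₂ A * kappaX A *
              max 0 (Real.log (n * l1Norm u / δopt))) := by
  refine ⟨56, by norm_num, fun m n A b x c u δfeas δopt hA hδ _ hle hfeas hopt => ?_⟩
  have hne := dualZeros_nonempty hδ.le hle hfeas hopt
  obtain ⟨j, hj1, hj2⟩ := exists_pow_two_between (one_le_kappaX (A := A))
  have hmem := isCertificate_attempt hA hδ hfeas.1 hne hj1
  -- Since the run with index `j` succeeds, the infimum is attained rather than the default 0 of an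
  -- empty set, and it is at most `j`.
  refine ⟨Nat.sInf_mem (s := {j : ℕ | IsCertificate A b c u x (2 * δopt)
    (attempt A b c u x δopt (2 ^ j)) (dualSlackPlus A c (attempt A b c u x δopt (2 ^ j)))
    (dualSlackMinus A c (attempt A b c u x δopt (2 ^ j)))}) ⟨j, hmem⟩,
    dualCertificateIterations_le hA hδ (le_trans ?_ hj2)⟩
  exact pow_le_pow_right₀ one_le_two (Nat.sInf_le hmem)
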